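/- Let $\mathcal V$ be a finitary many-sorted variety of algebras, i.e. the category of Eilenberg–Moore algebras of a finitary monad $T$ on $\mathbf{Set}^S$ for a set $S$ of sorts, and let $F\colon\mathcal V\to\mathcal V$ be an endofunctor preserving sifted colimits. An object is *free* if it is isomorphic to $(TY_0,\mu_{Y_0})$ for some $S$-sorted set $Y_0$, and *ffg* (free finitely generated) if it is isomorphic to $(TX_0,\mu_{X_0})$ for some $S$-sorted set $X_0$ with finitely many elements in total. *Definitions.* Let $G$ be an endofunctor of $\mathcal V$. An *ffg-equation* over $G$ is a morphism $e\colon X\to GX+A$ with $X$ ffg and $A$ arbitrary; a *solution* of it in a $G$-algebra $(A,a)$ is a morphism $s\colon X\to A$ with $s=[a,A]\cdot(Gs+A)\cdot e$. For $h\colon A\to B$ put $h\bullet e=(GX+h)\cdot e$. For $e\colon X\to GX+Z$ and $f\colon Z\to GZ+A$ let $$e\mathbin{\scriptstyle\blacksquare} f=\bigl(X+Z\xrightarrow{[e,\mathrm{inr}]}GX+Z\xrightarrow{GX+f}GX+GZ+A\xrightarrow{[G\mathrm{inl},G\mathrm{inr}]+A}G(X+Z)+A\bigr),$$ and for $w\colon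 X\to GX+C$ and a coalgebra $c\colon C\to GC$ let $w\mathbin{\scriptstyle\blacksquare}c\colon X+C\to G(X+C)$ be defined in the same way without the summand $A$. An *ffg-Elgot algebra* for $G$ is a $G$-algebra $(A,a)$ with an operation $\dagger$ assigning to every ffg-equation $e\colon X\to GX+A$ a solution $e^\dagger\colon X\to A$ such that 1. (weak functoriality) for all ffg-equations $e\colon X\to GX+Z$, $f\colon Y\to GY+Z$ with $Z$ ffg, every $m\colon X\to Y$ with $(Gm+Z)\cdot e=f\cdot m$ and every $h\colon Z\to A$, $(h\bullet f)^\dagger\cdot m=(h\bullet e)^\dagger$; 2. (compositionality) for all $e\colon X\to GX+Y$, $f\colon Y\to GY+A$ with $X,Y$ ffg, $(f^\dagger\bullet e)^\dagger=(e\mathbin{\scriptstyle\blacksquare}f)^\dagger\cdot\mathrm{inl}$. A morphism $(A,a,\dagger)\to(B,b,\ddagger)$ of ffg-Elgot algebras is a morphism $h\colon A\to B$ of $\mathcal V$ with $(h\bullet e)^\ddagger=h\cdot e^\dagger$ for all ffg-equations $e\colon X\to GX+A$. **Theorem.** Let $Y$ be a free object of $\mathcal V$ (possibly on infinitely many generators)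 and $G=F(-)+Y$. * The colimit $\Phi Y=\phi(F(-)+Y)$, in the category of $G$-coalgebras, of the inclusion of the full subcategory of all coalgebras with ffg carrier exists. Write $c^\sharp\colon C\to\Phi Y$ for its injections. Its coalgebra structure $\Phi Y\to F\Phi Y+Y$ is invertible, with inverse $[t_Y,\eta_Y]\colon F\Phi Y+Y\to\Phi Y$. * Every ffg-equation $e\colon X\to GX+\Phi Y$ over $G$ factorizes as $e=(GX+c^\sharp)\cdot w$ for some $w\colon X\to GX+C$ and some coalgebra $c\colon C\to GC$ with $C$ ffg; the morphism $e^\ddagger=(w\mathbin{\scriptstyle\blacksquare}c)^\sharp\cdot\mathrm{inl}$ does not depend on the factorization, and $(\Phi Y,[t_Y,\eta_Y],\ddagger)$ is an ffg-Elgot algebra for $G$. * For every ffg-equation $e\colon X\to FX+\Phi Y$ over $F$ put $e^\dagger=\overline e^{\,\ddagger}$, where $\overline e=\bigl(X\xrightarrow{e}FX+\Phi Y\to FX+Y+\Phi Y\bigr)$ is $e$ followed by the evident injection of the first and last summands. Then $(\Phi Y,t_Y,\dagger)$ is a free ffg-Elgot algebra for $F$ on $Y$ with universal arrow $\eta_Y$: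 it is an ffg-Elgot algebra for $F$, and for every ffg-Elgot algebra $(B,b,\ast)$ for $F$ and every morphism $h\colon Y\to B$ of $\mathcal V$ there is a unique morphism $p\colon(\Phi Y,t_Y,\dagger)\to(B,b,\ast)$ of ffg-Elgot algebras with $p\cdot\eta_Y=h$. -/

import Mathlib

open CategoryTheory CategoryTheory.Limits

universe u

namespace FfgElgot

/-! ## Varieties are cocomplete

A finitary many-sorted variety is presented as the category `T.Algebra` of Eilenberg-Moore algebras
of a finitary monad `T` on the category `S → Type u` of `S`-sorted sets. The following facts
provide the colimits (in particular the coproducts) of such a category. -/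

instance hasLimits_sortedSets (S : Type u) : HasLimits (S → Type u) where
  has_limits_of_shape _ _ := { has_limit := fun _ => pi.hasLimit_of_hasLimit_comp_eval }

instance hasLimits_algebra {S : Type u} (T : Monad (S → Type u)) : HasLimits T.Algebra where
  has_limits_of_shape _ _ :=
    { has_limit := fun D => Monad.hasLimit_of_comp_forget_hasLimit D }

/-- Image factorization of a morphism of sorted sets, with a section of the first factor. -/
theorem exists_image {S : Type u} {K X : S → Type u} (q : K ⟶ X) :
    ∃ (r : ∀ s, Setoid (K s)) (m : (fun s => Quotient (r s)) ⟶ X)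
      (e : K ⟶ fun s => Quotient (r s)) (t : (fun s => Quotient (r s)) ⟶ K),
      Mono m ∧ e ≫ m = q ∧ t ≫ q = m := by
  refine ⟨fun s => Setoid.ker (q s),
    fun s => TypeCat.ofHom (Quotient.lift (fun k => q s k) (fun _ _ h => h)),
    fun s => TypeCat.ofHom (Quotient.mk (Setoid.ker (q s))), fun s => TypeCat.ofHom Quotient.out, ⟨fun g h e => ?_⟩, ?_, ?_⟩
  · funext s
    ext x
    have h1 := ConcreteCategory.congr_hom (congr_fun e s) x
    have inj : Function.Injective
        (Quotient.lift (s := Setoid.ker (q s)) (fun k => q s k) (fun _ _ h => h)) := by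
      intro a b
      induction a using Quotient.ind
      induction b using Quotient.ind
      exact fun h => Quotient.sound h
    exact inj h1
  · rfl
  · funext s
    ext x
    induction x using Quotient.ind
    rename_i k
    exact Quotient.mk_out (s := Setoid.ker (q s)) k

/-- The image of a morphism out of a free algebra carries an algebra structure. -/
theorem exists_algebra_image {C : Type*} [Category C] (T : Monad C) (X : T.Algebra) {Z Q : C}
    (d : Z ⟶ X.A) (e : T.obj Z ⟶ Q) (m : Q ⟶ X.A) (t : Q ⟶ T.obj Z) [Mono m]
    (he : e ≫ m = T.map d ≫ X.a) (ht : t ≫ T.map d ≫ X.a = m) :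
    ∃ a : T.obj Q ⟶ Q, (T.η.app Q ≫ a = 𝟙 Q ∧ T.μ.app Q ≫ a = T.map a ≫ a) ∧
      a ≫ m = T.map m ≫ X.a := by
  have hq : T.μ.app Z ≫ T.map d ≫ X.a = T.map (T.map d ≫ X.a) ≫ X.a := by
    simp only [Functor.map_comp, Category.assoc, ← X.assoc]
    exact (T.μ.naturality_assoc d X.a).symm
  have ha : (T.map t ≫ T.μ.app Z ≫ e) ≫ m = T.map m ≫ X.a := by
    simp only [Category.assoc]
    rw [he, hq, ← Functor.map_comp_assoc, ht]
  generalize T.map t ≫ T.μ.app Z ≫ e = a at ha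
  refine ⟨a, ⟨?_, ?_⟩, ha⟩
  · rw [← cancel_mono m, Category.assoc, ha]
    have := T.η.naturality_assoc m X.a
    simp only [X.unit] at this
    exact this.symm.trans ((Category.comp_id m).trans (Category.id_comp m).symm)
  · rw [← cancel_mono m, Category.assoc, Category.assoc, ha, ← Functor.map_comp_assoc, ha,
      Functor.map_comp_assoc, ← X.assoc]
    exact (T.μ.naturality_assoc m X.a).symm

/-- A cocone on a diagram of algebras factors through any subalgebra that contains all its
components. -/
theorem exists_factor {C J : Type*} [Category C] [Category J] (T : Monad C) (D : J ⥤ T.Algebra)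
    (X B : T.Algebra) (h : D ⟶ (Functor.const J).obj X) (g : B ⟶ X) [Mono g.f]
    (l : ∀ j, (D.obj j).A ⟶ B.A) (hl : ∀ j, l j ≫ g.f = (h.app j).f) :
    ∃ f : D ⟶ (Functor.const J).obj B, f ≫ (Functor.const J).map g = h := by
  have hg : Mono g := (Monad.forget T).mono_of_mono_map (by assumption)
  let leg : ∀ j, D.obj j ⟶ B := fun j => ⟨l j, by
    rw [← cancel_mono g.f, Category.assoc, Category.assoc, hl, ← g.h, ← Functor.map_comp_assoc,
      hl]
    exact (h.app j).h⟩
  have hleg' : ∀ j, leg j ≫ g = h.app j := fun j => Monad.Algebra.Hom.ext (hl j)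
  refine ⟨{ app := leg, naturality := fun i j k => ?_ }, ?_⟩
  · have := h.naturality k
    simp only [Functor.const_obj_obj, Functor.const_obj_map, Category.comp_id] at this ⊢
    rw [← cancel_mono g, Category.assoc, hleg', hleg', this]
  · ext j : 2
    exact hleg' j

/-- The algebra structures on the quotients of a fixed sorted set. -/
structure QuotAlg {S : Type u} (T : Monad (S → Type u)) (K : S → Type u) : Type u where
  r : ∀ s, Setoid (K s)
  a : T.obj (fun s => Quotient (r s)) ⟶ fun s => Quotient (r s)
  unit : T.η.app _ ≫ a = 𝟙 _
  assoc : T.μ.app _ ≫ a = T.map a ≫ a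

/-- The underlying algebra. -/
def QuotAlg.alg {S : Type u} {T : Monad (S → Type u)} {K : S → Type u} (i : QuotAlg T K) :
    T.Algebra where
  A := fun s => Quotient (i.r s)
  a := i.a
  unit := i.unit
  assoc := i.assoc

/-- Every cocone factors through a quotient of the free algebra on the disjoint union of the
diagram. -/
theorem exists_quotAlg {S : Type u} (T : Monad (S → Type u)) {J : Type u} [SmallCategory J]
    (D : J ⥤ T.Algebra) (X : T.Algebra) (h : D ⟶ (Functor.const J).obj X) :
    ∃ (i : QuotAlg T (T.obj fun s => Σ j, (D.obj j).A s))
      (f : D ⟶ (Functor.const J).obj i.alg) (g : i.alg ⟶ X),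
      f ≫ (Functor.const J).map g = h := by
  let Z : S → Type u := fun s => Σ j, (D.obj j).A s
  let d : Z ⟶ X.A := fun s => TypeCat.ofHom fun z => (h.app z.1).f s z.2
  let inc : ∀ j, (D.obj j).A ⟶ Z := fun j s => TypeCat.ofHom fun x => ⟨j, x⟩
  have hinc : ∀ j, inc j ≫ d = (h.app j).f := fun j => rfl
  clear_value d inc
  have hq' : T.η.app Z ≫ T.map d ≫ X.a = d := by
    have := T.η.naturality_assoc d X.a
    rw [X.unit] at this
    exact this.symm.trans (Category.comp_id d)
  obtain ⟨r, m, e, t, hm, he, ht⟩ := exists_image (T.map d ≫ X.a)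
  obtain ⟨a, hlaw, ha⟩ := exists_algebra_image T X d e m t he ht
  let i : QuotAlg T (T.obj Z) := ⟨r, a, hlaw.1, hlaw.2⟩
  let g : i.alg ⟶ X := ⟨m, ha.symm⟩
  have hg : Mono g.f := hm
  obtain ⟨f, hf⟩ := exists_factor T D X i.alg h g (fun j => inc j ≫ T.η.app Z ≫ e) (fun j => by
      change (inc j ≫ T.η.app Z ≫ e) ≫ m = _
      rw [← hinc, Category.assoc, Category.assoc, he, hq'])
  exact ⟨i, f, g, hf⟩

/-- Cocones on a small diagram of algebras have a small solution set. -/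
theorem solutionSet {S : Type u} (T : Monad (S → Type u)) (J : Type u) [SmallCategory J] :
    SolutionSetCondition.{u} (Functor.const J : T.Algebra ⥤ J ⥤ T.Algebra) := by
  intro D
  refine ⟨Σ i : QuotAlg T (T.obj fun s => Σ j, (D.obj j).A s), D ⟶ (Functor.const J).obj i.alg,
    fun i => i.1.alg, fun i => i.2, fun X h => ?_⟩
  obtain ⟨i, f, g, w⟩ := exists_quotAlg T D X h
  exact ⟨⟨i, f⟩, g, w⟩

instance hasColimits_algebra {S : Type u} (T : Monad (S → Type u)) : HasColimits T.Algebra where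
  has_colimits_of_shape J _ := hasColimitsOfShape_iff_isRightAdjoint_const.2
    (isRightAdjoint_of_preservesLimits_of_solutionSetCondition _ (solutionSet T J))
instance hasBinaryCoproducts_algebra {S : Type u} (T : Monad (S → Type u)) :
    HasBinaryCoproducts T.Algebra :=
  have : HasFiniteColimits T.Algebra := hasFiniteColimits_of_hasColimits _
  inferInstance

/-! ## Free and free finitely generated objects, sifted colimits -/

section Variety

variable {S : Type u} (T : Monad (S → Type u))

/-- Free objects: those isomorphic to `(T Y₀, μ)` for some `S`-sorted set `Y₀`. -/
def IsFreeObject : ObjectProperty T.Algebra := fun Y =>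
  ∃ Y₀ : S → Type u, Nonempty (Y ≅ T.free.obj Y₀)

/-- Free finitely generated (ffg) objects: those isomorphic to `(T X₀, μ)` for some finite
`S`-sorted set `X₀`, i.e. one for which the coproduct of all components `X₀ s` is finite. -/
def IsFfg : ObjectProperty T.Algebra := fun X =>
  ∃ X₀ : S → Type u, Finite (Σ s, X₀ s) ∧ Nonempty (X ≅ T.free.obj X₀)

instance : (IsFfg T).IsClosedUnderIsomorphisms where
  of_iso := fun e ⟨X₀, h, ⟨i⟩⟩ => ⟨X₀, h, ⟨e.symm ≪≫ i⟩⟩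

/-- The coproduct of two sorted sets. -/
def sumCofan (X Y : S → Type u) : BinaryCofan X Y :=
  BinaryCofan.mk (P := fun s => X s ⊕ Y s) (fun _ => TypeCat.ofHom Sum.inl)
    (fun _ => TypeCat.ofHom Sum.inr)

/-- Its universal property. -/
def sumCofanIsColimit (X Y : S → Type u) : IsColimit (sumCofan X Y) :=
  BinaryCofan.isColimitMk
    (fun c s => TypeCat.ofHom (Sum.elim (fun x => c.inl s x) (fun y => c.inr s y)))
    (fun _ => rfl) (fun _ => rfl)
    (fun c m h₁ h₂ => by
      funext s
      ext x
      cases x with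
      | inl x => exact ConcreteCategory.congr_hom (congr_fun h₁ s) x
      | inr y => exact ConcreteCategory.congr_hom (congr_fun h₂ s) y)

instance : (IsFfg T).IsClosedUnderBinaryCoproducts :=
  .mk' (by
    rintro _ ⟨F, hF⟩
    obtain ⟨X, hX, ⟨i⟩⟩ := hF ⟨.left⟩
    obtain ⟨Y, hY, ⟨j⟩⟩ := hF ⟨.right⟩
    have : T.free.IsLeftAdjoint := ⟨_, ⟨T.adj⟩⟩
    refine ⟨fun s => X s ⊕ Y s, Finite.of_equiv _ (Equiv.sigmaSumDistrib X Y).symm, ⟨?_⟩⟩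
    exact (colimit.isColimit F).coconePointsIsoOfNatIso
      (mapIsColimitOfPreservesOfIsColimit T.free _ _ (sumCofanIsColimit X Y))
      (diagramIsoPair F ≪≫ mapPairIso i j))

end Variety

/-- Preservation of sifted colimits (of small diagrams). -/
def PreservesSiftedColimits {C : Type*} [Category C] {D : Type*} [Category D] (F : C ⥤ D) : Prop :=
  ∀ (J : Type u) [SmallCategory J] [IsSifted J], PreservesColimitsOfShape J F

/-! ## Equations, solutions, and Elgot algebras

The notions are stated for an arbitrary class `P` of objects of variables; ffg-Elgot algebras are
the case where `P` is the class of ffg objects. An equation over `F` with variables `X` and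
parameters `A` is a morphism `e : X ⟶ F.obj X ⨿ A`. -/

section Elgot

variable {C : Type*} [Category C] [HasBinaryCoproducts C]

/-- The functor `F(-) + Y`. -/
noncomputable def plusConst (F : C ⥤ C) (Y : C) : C ⥤ C where
  obj X := F.obj X ⨿ Y
  map f := coprod.map (F.map f) (𝟙 Y)

/-- The injection `FX ⟶ FX + Y`. -/
noncomputable def plusInl (F : C ⥤ C) (Y X : C) : F.obj X ⟶ (plusConst F Y).obj X :=
  coprod.inl

/-- The injection `Y ⟶ FX + Y`. -/
noncomputable def plusInr (F : C ⥤ C) (Y X : C) : Y ⟶ (plusConst F Y).obj X :=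
  coprod.inr

/-- The equation `h • e = (FX + h) ⬝ e`, with parameters renamed along `h`. -/
noncomputable def rename {F : C ⥤ C} {X A B : C} (h : A ⟶ B) (e : X ⟶ F.obj X ⨿ A) :
    X ⟶ F.obj X ⨿ B :=
  e ≫ coprod.map (𝟙 (F.obj X)) h

/-- The canonical morphism `[F inl, F inr] : FX + FY ⟶ F(X + Y)`. -/
noncomputable def can (F : C ⥤ C) (X Y : C) : F.obj X ⨿ F.obj Y ⟶ F.obj (X ⨿ Y) :=
  coprod.desc (F.map coprod.inl) (F.map coprod.inr)

/-- The combined equation `e ▪ f`, the composite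
`X + Y ⟶ FX + Y ⟶ FX + (FY + Z) ≅ (FX + FY) + Z ⟶ F(X + Y) + Z`
of `[e, inr]`, `FX + f` and `can + Z`. -/
noncomputable def combine {F : C ⥤ C} {X Y Z : C} (e : X ⟶ F.obj X ⨿ Y) (f : Y ⟶ F.obj Y ⨿ Z) :
    X ⨿ Y ⟶ F.obj (X ⨿ Y) ⨿ Z :=
  coprod.desc e coprod.inr ≫ coprod.map (𝟙 (F.obj X)) f ≫
    (coprod.associator (F.obj X) (F.obj Y) Z).inv ≫ coprod.map (can F X Y) (𝟙 Z)

/-- The coalgebra `w ▪ c` for an equation `w : X ⟶ FX + C` and a coalgebra `c : C ⟶ FC`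
(an equation without parameters). -/
noncomputable def combineCoalgebra {F : C ⥤ C} {X : C} (c : Endofunctor.Coalgebra F)
    (w : X ⟶ F.obj X ⨿ c.V) : Endofunctor.Coalgebra F where
  V := X ⨿ c.V
  str := coprod.desc w coprod.inr ≫ coprod.map (𝟙 (F.obj X)) c.str ≫ can F X c.V

/-- `s` is a solution of the equation `e` in the `F`-algebra `(A, a)`:
`s = [a, A] ⬝ (Fs + A) ⬝ e`. -/
def IsSolution {F : C ⥤ C} {X A : C} (a : F.obj A ⟶ A) (e : X ⟶ F.obj X ⨿ A) (s : X ⟶ A) : Prop :=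
  s = e ≫ coprod.map (F.map s) (𝟙 A) ≫ coprod.desc a (𝟙 A)

/-- Operations that assign a morphism `X ⟶ A` to every equation `X ⟶ FX + A` with variable object
`X` in `P`. -/
abbrev SolutionOperation (P : ObjectProperty C) (F : C ⥤ C) (A : C) :=
  ∀ ⦃X : C⦄, P X → (X ⟶ F.obj X ⨿ A) → (X ⟶ A)

variable (P : ObjectProperty C) [P.IsClosedUnderBinaryCoproducts]

/-- `(A, a, sol)` is an Elgot algebra for `F` with respect to variable objects in `P`. -/
structure IsElgot (F : C ⥤ C) {A : C} (a : F.obj A ⟶ A) (sol : SolutionOperation P F A) :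
    Prop where
  isSolution : ∀ ⦃X : C⦄ (hX : P X) (e : X ⟶ F.obj X ⨿ A), IsSolution a e (sol hX e)
  weakFunctoriality : ∀ ⦃X Y Z : C⦄ (hX : P X) (hY : P Y) (_ : P Z)
    (e : X ⟶ F.obj X ⨿ Z) (f : Y ⟶ F.obj Y ⨿ Z) (m : X ⟶ Y),
    e ≫ coprod.map (F.map m) (𝟙 Z) = m ≫ f →
    ∀ h : Z ⟶ A, m ≫ sol hY (rename h f) = sol hX (rename h e)
  compositionality : ∀ ⦃X Y : C⦄ (hX : P X) (hY : P Y)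
    (e : X ⟶ F.obj X ⨿ Y) (f : Y ⟶ F.obj Y ⨿ A),
    sol hX (rename (sol hY f) e) = coprod.inl ≫ sol (P.prop_coprod X Y hX hY) (combine e f)

/-- Elgot algebras for `F` with respect to variable objects in `P`. -/
structure ElgotAlgebra (F : C ⥤ C) where
  /-- the carrier -/
  carrier : C
  /-- the algebra structure -/
  str : F.obj carrier ⟶ carrier
  /-- the solution operation -/
  sol : SolutionOperation P F carrier
  isElgot : IsElgot P F str sol

/-- Morphisms of Elgot algebras: morphisms of the base category that preserve solutions. -/
@[ext]
structure ElgotAlgebra.Hom {F : C ⥤ C} (A B : ElgotAlgebra P F) where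
  /-- the underlying morphism -/
  hom : A.carrier ⟶ B.carrier
  preserves : ∀ ⦃X : C⦄ (hX : P X) (e : X ⟶ F.obj X ⨿ A.carrier),
    B.sol hX (rename hom e) = A.sol hX e ≫ hom

instance (F : C ⥤ C) : Category (ElgotAlgebra P F) where
  Hom A B := ElgotAlgebra.Hom P A B
  id A :=
    { hom := 𝟙 A.carrier
      preserves := fun X hX e => by simp [rename] }
  comp f g :=
    { hom := f.hom ≫ g.hom
      preserves := fun X hX e => by
        rw [← Category.assoc, ← f.preserves, ← g.preserves]
        simp [rename] }

/-! ## The colimit of all coalgebras with carrier in `P` -/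

/-- The inclusion of the full subcategory of coalgebras with carrier in `P` into all
coalgebras. -/
def coalgebraInclusion (F : C ⥤ C) :
    ObjectProperty.FullSubcategory (fun c : Endofunctor.Coalgebra F => P c.V) ⥤
      Endofunctor.Coalgebra F :=
  ObjectProperty.ι _

variable {P}

/-- The component `c♯ : C ⟶ Φ` of a cocone on the coalgebras with carrier in `P`. -/
def component {F : C ⥤ C} (Φ : Cocone (coalgebraInclusion P F)) (c : Endofunctor.Coalgebra F)
    (hc : P c.V) : c.V ⟶ Φ.pt.V :=
  (Φ.ι.app ⟨c, hc⟩).f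

/-- The solution operation on the colimit `Φ` of all coalgebras with carrier in `P`: every equation
`e : X ⟶ FX + Φ` factorizes as `e = (FX + c♯) ⬝ w` through some such coalgebra `c`, and for every
such factorization the solution of `e` is `(w ▪ c)♯ ⬝ inl`. (There is at most one operation with
this property.) -/
def IsCanonicalSolution {F : C ⥤ C} (Φ : Cocone (coalgebraInclusion P F))
    (sol : SolutionOperation P F Φ.pt.V) : Prop :=
  ∀ ⦃X : C⦄ (hX : P X) (e : X ⟶ F.obj X ⨿ Φ.pt.V),
    (∃ (c : Endofunctor.Coalgebra F) (hc : P c.V) (w : X ⟶ F.obj X ⨿ c.V),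
      e = rename (component Φ c hc) w) ∧
    ∀ (c : Endofunctor.Coalgebra F) (hc : P c.V) (w : X ⟶ F.obj X ⨿ c.V),
      e = rename (component Φ c hc) w →
      sol hX e =
        coprod.inl ≫ component Φ (combineCoalgebra c w) (P.prop_coprod X c.V hX hc)

/-- The solution operation for `F` induced by one for `F(-) + Y`: the solution of
`e : X ⟶ FX + A` is the one of `X ⟶ FX + A ⟶ (FX + Y) + A`. -/
noncomputable def inducedSolution {F : C ⥤ C} {Y A : C}
    (sol : SolutionOperation P (plusConst F Y) A) : SolutionOperation P F A :=
  fun X hX e => sol hX (e ≫ coprod.map (plusInl F Y X) (𝟙 A))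

/-- `(E, η)` is a free Elgot algebra for `F` on `Y`: `η` is a universal arrow from `Y` to the
forgetful functor. -/
def IsFreeOn {F : C ⥤ C} {Y : C} (E : ElgotAlgebra P F) (η : Y ⟶ E.carrier) : Prop :=
  ∀ (B : ElgotAlgebra P F) (h : Y ⟶ B.carrier), ∃! p : E ⟶ B, η ≫ p.hom = h

end Elgot

section FixedPoint

variable {C : Type*} [Category C] [HasBinaryCoproducts C] {F : C ⥤ C} {Y : C}

/-- The component `t_Y : FΦ ⟶ Φ` of the inverse of an invertible coalgebra structure
`Φ ⟶ FΦ + Y`. -/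
noncomputable def invLeft (Φ : Endofunctor.Coalgebra (plusConst F Y)) [IsIso Φ.str] :
    F.obj Φ.V ⟶ Φ.V :=
  plusInl F Y Φ.V ≫ inv Φ.str

/-- The component `η_Y : Y ⟶ Φ` of the inverse of an invertible coalgebra structure
`Φ ⟶ FΦ + Y`. -/
noncomputable def invRight (Φ : Endofunctor.Coalgebra (plusConst F Y)) [IsIso Φ.str] :
    Y ⟶ Φ.V :=
  plusInr F Y Φ.V ≫ inv Φ.str

end FixedPoint

end FfgElgot

/-!
Write `G = F(-) + Y`. The theorem rests on two properties of the variety `T.Algebra`: ffg objects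
are perfectly presentable, i.e. `Hom(X, -)` preserves sifted colimits for `X` ffg
(`preservesColimitsOfShape_coyoneda_of_isFfg`), and the `G`-coalgebras with ffg carrier form an
essentially small category with binary coproducts, which is therefore sifted. For the first one, a
finitary functor on sorted sets preserves sifted colimits
(`preservesColimitsOfShape_of_finitary`), hence so does the forgetful functor of `T.Algebra`.

Colimits of coalgebras are formed on carriers, so `Φ` is a sifted colimit of the carriers `V` of the
coalgebras `(V, s)` with ffg carrier, and it is preserved by `G` and by every functor `A + (-)`.
Thus every morphism from an ffg object `X` to `Φ`, `GΦ` or `A + Φ` factors through some `V`, `GV` or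
`A + V`, and two factorizations are connected by a zigzag of coalgebra morphisms
(`eq_of_comp_map_leg_eq`). From this follow

* the invertibility of the structure of `Φ` (`isIso_str`): a factorization `X ⟶ GV` of a morphism
  `X ⟶ GΦ` turns `X + V` into a coalgebra, whose component restricted to `X` is a lift to `Φ`;
* the independence of the canonical solution `(w ▪ c)♯ ⬝ inl` of the factorization, since it is
  natural in `(w, c)` (`inl_leg_combineStr_naturality`);
* the axioms of Elgot algebras (`isElgot_of_isCanonicalSolution`), each of which expresses that a
  certain map between carriers of coalgebras `w ▪ c` is a coalgebra morphism.

For freeness (`isFreeOn`), a `G`-coalgebra `C ⟶ FC + Y` is an equation over `F` with parameters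
in `Y`. Given an Elgot algebra `B` and `h : Y ⟶ B`, the solutions in `B` of the equations `h • c`
form a cocone. Here weak functoriality is needed with parameter object `Y`, which need not be
ffg; but the free object `Y` is a directed colimit of ffg objects, and both equations and their
morphisms descend to a stage of that colimit (`IsElgot.comp_sol_rename`). The induced morphism
`Φ ⟶ B` preserves solutions by compositionality in `B`. It is unique because each component `c♯`
is itself the solution in `Φ` of the equation `η • c` (`inducedSolution_rename_invRight`).
-/

namespace FfgElgot

/-! ### Morphisms into colimits -/

section HomsIntoColimits

variable {C : Type*} [Category.{u} C] {J : Type*} [Category J] {K : J ⥤ C} {c : Cocone K}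

theorem exists_hom_of_isColimit (hc : IsColimit c) {X : C}
    [PreservesColimit K (coyoneda.obj (.op X))] (f : X ⟶ c.pt) :
    ∃ (j : J) (g : X ⟶ K.obj j), g ≫ c.ι.app j = f :=
  Types.jointly_surjective_of_isColimit
    (isColimitOfPreserves (coyoneda.obj (.op X)) hc) f

/-- A cocone on a diagram of types identifies elements that the colimit cocone identifies. -/
theorem cocone_app_eq_of_isColimit {K : J ⥤ Type u} {c : Cocone K} (hc : IsColimit c)
    {β : Type u} (Ψ : ∀ j, K.obj j → β)
    (hΨ : ∀ ⦃j k : J⦄ (v : j ⟶ k) (x : K.obj j), Ψ k (K.map v x) = Ψ j x)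
    {j k : J} {x : K.obj j} {y : K.obj k} (h : c.ι.app j x = c.ι.app k y) : Ψ j x = Ψ k y := by
  let s : Cocone K :=
    { pt := β
      ι := { app := fun j => TypeCat.ofHom (Ψ j), naturality := fun j k v => by
              ext x; exact hΨ v x } }
  have e (j : J) (x : K.obj j) : hc.desc s (c.ι.app j x) = Ψ j x :=
    ConcreteCategory.congr_hom (hc.fac s j) x
  rw [← e, ← e, h]

/-- If `Hom(X, -)` preserves a colimit, then any assignment that is invariant under the
transition maps of the diagram takes the same value on two morphisms with domain `X` that become
equal in the colimit. -/
theorem eq_of_comp_ι_eq (hc : IsColimit c) {X : C}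
    [PreservesColimit K (coyoneda.obj (.op X))] {β : Type u} (Ψ : ∀ j, (X ⟶ K.obj j) → β)
    (hΨ : ∀ ⦃j k : J⦄ (v : j ⟶ k) (f : X ⟶ K.obj j), Ψ k (f ≫ K.map v) = Ψ j f)
    {j k : J} {f : X ⟶ K.obj j} {g : X ⟶ K.obj k} (h : f ≫ c.ι.app j = g ≫ c.ι.app k) :
    Ψ j f = Ψ k g :=
  cocone_app_eq_of_isColimit (isColimitOfPreserves (coyoneda.obj (.op X)) hc) Ψ
    (fun _ _ v f => hΨ v f) h

/-- A cocone on a diagram of types is a colimit if it is jointly surjective and every cocone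
identifies the elements that it identifies. -/
theorem nonempty_isColimit_of_types {K : J ⥤ Type u} (c : Cocone K)
    (surj : ∀ x : c.pt, ∃ (j : J) (y : K.obj j), c.ι.app j y = x)
    (inj : ∀ (s : Cocone K) (j k : J) (y : K.obj j) (z : K.obj k),
      c.ι.app j y = c.ι.app k z → s.ι.app j y = s.ι.app k z) :
    Nonempty (IsColimit c) := by
  choose i r hr using surj
  refine ⟨{ desc := fun s => TypeCat.ofHom fun x => s.ι.app (i x) (r x), fac := ?_, uniq := ?_ }⟩
  · intro s j
    ext x
    exact inj s _ _ _ _ (hr _)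
  · intro s m hm
    ext x
    have := ConcreteCategory.congr_hom (hm (i x)) (r x)
    simp only [ConcreteCategory.comp_apply, hr] at this
    exact this

end HomsIntoColimits

/-! ### Sorted sets -/

section SortedSets

variable {S : Type u} {J : Type u} [SmallCategory J]

/-- Colimits of sorted sets are computed sortwise. -/
instance preservesColimitsOfShape_eval (s : S) :
    PreservesColimitsOfShape J (Pi.eval (fun _ : S => Type u) s) where
  preservesColimit {K} := preservesColimit_of_preserves_colimit_cocone
    (pi.coconeOfCoconeEvalIsColimit fun i =>
      colimit.isColimit (K ⋙ Pi.eval (fun _ : S => Type u) i))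
    (colimit.isColimit (K ⋙ Pi.eval (fun _ : S => Type u) s))

/-- The diagram of finite products of a finite family of diagrams of types. -/
def piDiagram {n : ℕ} (H : Fin n → J ⥤ Type u) : J ⥤ Type u where
  obj j := ∀ i, (H i).obj j
  map v := TypeCat.ofHom fun x i => (H i).map v (x i)

/-- The projections of `piDiagram`. -/
def piDiagramFan {n : ℕ} (H : Fin n → J ⥤ Type u) : Fan H :=
  Fan.mk (piDiagram H) fun i => { app := fun j => TypeCat.ofHom fun x => x i }

/-- Its universal property. -/
def piDiagramFanIsLimit {n : ℕ} (H : Fin n → J ⥤ Type u) : IsLimit (piDiagramFan H) :=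
  Fan.IsLimit.mk _
    (fun s => { app := fun j => TypeCat.ofHom fun x i => (s.proj i).app j x
                naturality := fun j k v => by
                  ext x
                  funext i
                  exact ConcreteCategory.congr_hom ((s.proj i).naturality v) x })
    (fun s i => rfl)
    (fun s m hm => by
      ext j x
      funext i
      exact ConcreteCategory.congr_hom (NatTrans.congr_app (hm i) j) x)

variable [IsSifted J]

/-- For sifted `J`, the colimit of a finite product of diagrams of types is the product of the
colimits. -/
theorem bijective_colimit_piDiagram {n : ℕ} (H : Fin n → J ⥤ Type u) :
    Function.Bijective fun (x : colimit (piDiagram H)) (i : Fin n) =>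
      colim.map ((piDiagramFan H).proj i) x := by
  have := PreservesFiniteProducts.preserves (F := (colim : (J ⥤ Type u) ⥤ Type u)) n
  have hl := isLimitOfPreserves (colim : (J ⥤ Type u) ⥤ Type u) (piDiagramFanIsLimit H)
  constructor
  · intro x y h
    exact Concrete.isLimit_ext _ hl x y fun ⟨i⟩ => congr_fun h i
  · intro x
    let s : Cone (Discrete.functor H ⋙ (colim : (J ⥤ Type u) ⥤ Type u)) :=
      { pt := PUnit
        π := Discrete.natTrans fun i => TypeCat.ofHom fun _ => x i.as }
    refine ⟨hl.lift s PUnit.unit, funext fun i => ?_⟩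
    exact ConcreteCategory.congr_hom (hl.fac s ⟨i⟩) PUnit.unit

theorem preservesColimitsOfShape_coyoneda_of_finite (X : S → Type u) (hX : Finite (Σ s, X s)) :
    PreservesColimitsOfShape J (coyoneda.obj (.op X)) where
  preservesColimit {K} := ⟨fun {c} hc => by
    obtain ⟨n, ⟨e⟩⟩ := Finite.exists_equiv_fin (Σ s, X s)
    -- a morphism out of `X` is an `n`-tuple of elements
    let H (i : Fin n) : J ⥤ Type u := K ⋙ Pi.eval (fun _ : S => Type u) (e.symm i).1
    let hom {A : S → Type u} (x : ∀ i, A (e.symm i).1) : X ⟶ A := fun s =>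
      TypeCat.ofHom fun a => cast (by rw [e.symm_apply_apply]) (x (e ⟨s, a⟩))
    let tup {A : S → Type u} (f : X ⟶ A) (i : Fin n) : A (e.symm i).1 := f _ (e.symm i).2
    have tup_comp {A B : S → Type u} (f : X ⟶ A) (g : A ⟶ B) :
      tup (f ≫ g) = fun i => g _ (tup f i) := rfl
    have tup_inj {A : S → Type u} {f g : X ⟶ A} (h : tup f = tup g) : f = g := by
      funext s
      ext a
      have := congr_fun h (e ⟨s, a⟩)
      simp only [tup] at this
      rw [e.symm_apply_apply] at this
      exact this
    have tup_hom {A : S → Type u} (x : ∀ i, A (e.symm i).1) : tup (hom x) = x := by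
      funext i
      simp only [tup, hom]
      refine eq_of_heq ((cast_heq _ _).trans ?_)
      have : e ⟨(e.symm i).1, (e.symm i).2⟩ = i := e.apply_symm_apply i
      rw [this]
    have hH (i : Fin n) := isColimitOfPreserves (Pi.eval (fun _ : S => Type u) (e.symm i).1) hc
    let φ (i : Fin n) : colimit (H i) ≅ c.pt (e.symm i).1 :=
      (colimit.isColimit (H i)).coconePointUniqueUpToIso (hH i)
    have hφ (i : Fin n) (j : J) (y : (H i).obj j) :
        (φ i).hom (colimit.ι (H i) j y) = c.ι.app j _ y :=
      ConcreteCategory.congr_hom ((colimit.isColimit (H i)).comp_coconePointUniqueUpToIso_hom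
        (hH i) j) y
    have hπ (i : Fin n) (j : J) (y : (piDiagram H).obj j) :
        colim.map ((piDiagramFan H).proj i) (colimit.ι (piDiagram H) j y) =
          colimit.ι (H i) j (y i) :=
      ConcreteCategory.congr_hom (colimit.ι_map ((piDiagramFan H).proj i) j) y
    apply nonempty_isColimit_of_types
    · intro f
      obtain ⟨x, hx⟩ := (bijective_colimit_piDiagram H).2 fun i => (φ i).inv (tup f i)
      obtain ⟨j, y, rfl⟩ := Types.jointly_surjective_of_isColimit (colimit.isColimit _) x
      refine ⟨j, hom y, tup_inj ?_⟩
      refine (tup_comp (hom y) (c.ι.app j)).trans ?_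
      funext i
      refine (congr_arg (c.ι.app j _) (congr_fun (tup_hom y) i)).trans ?_
      refine ((hφ i j _).symm.trans (congr_arg (φ i).hom (hπ i j y).symm)).trans ?_
      refine (congr_arg (φ i).hom (congr_fun hx i)).trans ?_
      exact ConcreteCategory.congr_hom (φ i).inv_hom_id _
    · intro s j k f g h
      have key : colimit.ι (piDiagram H) j (tup f) = colimit.ι (piDiagram H) k (tup g) := by
        refine (bijective_colimit_piDiagram H).1 (funext fun i => ?_)
        refine (hπ i j _).trans (Eq.trans ?_ (hπ i k _).symm)
        refine (φ i).toEquiv.injective ?_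
        refine (hφ i j _).trans (Eq.trans ?_ (hφ i k _).symm)
        exact congr_fun (congr_arg tup h) i
      have := cocone_app_eq_of_isColimit (colimit.isColimit (piDiagram H))
        (fun j x => s.ι.app j (hom x)) (fun j k v x => ?_) key
      · have hh {A : S → Type u} (f : X ⟶ A) : hom (tup f) = f := tup_inj (tup_hom _)
        simpa only [hh] using this
      · refine Eq.trans ?_ (ConcreteCategory.congr_hom (s.w v) (hom x))
        refine congr_arg (s.ι.app k) (tup_inj ?_)
        refine (tup_hom _).trans ?_
        exact funext fun i => congr_arg (K.map v _) (congr_fun (tup_hom x) i).symm⟩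

end SortedSets

/-! ### Finitary functors on sorted sets preserve sifted colimits -/

section Finitary

variable {S : Type u}

/-- The directed diagram of the finite subsets of a sorted set. -/
def finiteSubsets (A : S → Type u) : Finset (Σ s, A s) ⥤ (S → Type u) where
  obj E s := {a : A s // (⟨s, a⟩ : Σ s, A s) ∈ E}
  map v _ := TypeCat.ofHom fun a => ⟨a.1, leOfHom v a.2⟩

/-- The inclusion of a finite subset. -/
def finiteSubsetsι (A : S → Type u) (E : Finset (Σ s, A s)) : (finiteSubsets A).obj E ⟶ A :=
  fun _ => TypeCat.ofHom fun a => a.1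

/-- The cocone of the inclusions of the finite subsets. -/
def finiteSubsetsCocone (A : S → Type u) : Cocone (finiteSubsets A) where
  pt := A
  ι := { app := finiteSubsetsι A }

/-- A sorted set is the directed union of its finite subsets. -/
def finiteSubsetsIsColimit (A : S → Type u) : IsColimit (finiteSubsetsCocone A) where
  desc c s := TypeCat.ofHom fun a => c.ι.app {⟨s, a⟩} s ⟨a, Finset.mem_singleton_self _⟩
  fac c E := by
    funext s
    ext a
    have hE : ({⟨s, a.1⟩} : Finset (Σ s, A s)) ≤ E := Finset.singleton_subset_iff.2 a.2
    exact (ConcreteCategory.congr_hom (congr_fun (c.w (homOfLE hE)) s) ⟨a.1, _⟩).symm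
  uniq c m hm := by
    funext s
    ext a
    exact ConcreteCategory.congr_hom (congr_fun (hm {⟨s, a⟩}) s) ⟨a, _⟩

theorem finite_finiteSubsets {A : S → Type u} (E : Finset (Σ s, A s)) :
    Finite (Σ s, (finiteSubsets A).obj E s) :=
  Finite.of_injective (β := E) (fun p => ⟨⟨p.1, p.2.1⟩, p.2.2⟩) (by
    rintro ⟨s, a, ha⟩ ⟨t, b, hb⟩ h
    have h := congr_arg Subtype.val h
    dsimp only at h
    cases h
    rfl)

/-- Elements of `H A` come from finite subsets of `A`, and equalities between them hold already
over a finite subset. Maps from finite sorted sets into a sifted colimit factor through the diagram,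
essentially uniquely, which gives both halves of the claim. -/
theorem preservesColimitsOfShape_of_preservesFilteredColimits (H : (S → Type u) ⥤ Type u)
    [PreservesFilteredColimits H] (J : Type u) [SmallCategory J] [IsSifted J] :
    PreservesColimitsOfShape J H where
  preservesColimit {K} := ⟨fun {c} hc => by
    have hfin (E : Finset (Σ s, c.pt s)) : PreservesColimitsOfShape J
        (coyoneda.obj (.op ((finiteSubsets c.pt).obj E))) :=
      preservesColimitsOfShape_coyoneda_of_finite _ (finite_finiteSubsets E)
    have hfin' (j : J) (E : Finset (Σ s, K.obj j s)) : PreservesColimitsOfShape J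
        (coyoneda.obj (.op ((finiteSubsets (K.obj j)).obj E))) :=
      preservesColimitsOfShape_coyoneda_of_finite _ (finite_finiteSubsets E)
    have hH (A : S → Type u) := isColimitOfPreserves H (finiteSubsetsIsColimit A)
    have hfac (E : Finset (Σ s, c.pt s)) : ∃ (j : J)
        (g : (finiteSubsets c.pt).obj E ⟶ K.obj j),
        g ≫ c.ι.app j = finiteSubsetsι c.pt E :=
      exists_hom_of_isColimit hc (X := (finiteSubsets c.pt).obj E) _
    apply nonempty_isColimit_of_types
    · intro x
      obtain ⟨E, x, rfl⟩ := Types.jointly_surjective_of_isColimit (hH c.pt) x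
      obtain ⟨j, g, hg⟩ := hfac E
      refine ⟨j, H.map g x, ?_⟩
      change (H.map g ≫ H.map (c.ι.app j)) x = H.map _ x
      rw [← H.map_comp, hg]
      rfl
    · -- the image of a finite subset of some `K j` is a finite subset of the colimit
      classical
      let f (j : J) (p : Σ s, K.obj j s) : Σ s, c.pt s := ⟨p.1, c.ι.app j p.1 p.2⟩
      have himg (j : J) (x : H.obj (K.obj j)) : ∃ (E : Finset (Σ s, K.obj j s))
          (E' : Finset (Σ s, c.pt s)) (x' : H.obj ((finiteSubsets (K.obj j)).obj E))
          (r : (finiteSubsets (K.obj j)).obj E ⟶ (finiteSubsets c.pt).obj E'),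
          r ≫ finiteSubsetsι c.pt E' =
            finiteSubsetsι (K.obj j) E ≫ c.ι.app j ∧
          H.map (finiteSubsetsι (K.obj j) E) x' = x := by
        obtain ⟨E, x', hx⟩ := Types.jointly_surjective_of_isColimit (hH (K.obj j)) x
        exact ⟨E, E.image (f j), x',
          fun s => TypeCat.ofHom fun a =>
            ⟨c.ι.app j s a.1, Finset.mem_image_of_mem (f j) a.2⟩, rfl, hx⟩
      intro s j k y z h
      obtain ⟨E₁, E₁', y, r₁, hr₁, rfl⟩ := himg j y
      obtain ⟨E₂, E₂', z, r₂, hr₂, rfl⟩ := himg k z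
      have h' : H.map (finiteSubsetsι c.pt E₁') (H.map r₁ y) =
          H.map (finiteSubsetsι c.pt E₂') (H.map r₂ z) := by
        have e₁ := ConcreteCategory.congr_hom (congr_arg H.map hr₁) y
        have e₂ := ConcreteCategory.congr_hom (congr_arg H.map hr₂) z
        rw [H.map_comp, H.map_comp] at e₁ e₂
        exact e₁.trans (h.trans e₂.symm)
      obtain ⟨E, v, w, hE⟩ := (Types.FilteredColimit.isColimit_eq_iff _ (hH c.pt)).1 h'
      obtain ⟨l, g, hg⟩ := hfac E
      -- both elements agree with the one obtained from the finite subset `E` at the index `l`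
      have key {i : J} {D : Finset (Σ s, K.obj i s)} {D' : Finset (Σ s, c.pt s)}
          (x : H.obj ((finiteSubsets (K.obj i)).obj D))
          (r : (finiteSubsets (K.obj i)).obj D ⟶ (finiteSubsets c.pt).obj D')
          (hr : r ≫ finiteSubsetsι c.pt D' =
            finiteSubsetsι (K.obj i) D ≫ c.ι.app i) (v : D' ⟶ E) :
          s.ι.app i (H.map (finiteSubsetsι (K.obj i) D) x) =
            s.ι.app l (H.map g (H.map ((finiteSubsets c.pt).map v) (H.map r x))) := by
        have := eq_of_comp_ι_eq.{u} hc (X := (finiteSubsets (K.obj i)).obj D)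
          (fun i f => s.ι.app i (H.map f x)) (fun i i' u f => ?_)
          (f := finiteSubsetsι (K.obj i) D)
          (g := r ≫ (finiteSubsets c.pt).map v ≫ g) ?_
        · rw [H.map_comp, H.map_comp] at this
          exact this
        · rw [H.map_comp]
          exact ConcreteCategory.congr_hom (s.w u) (H.map f x)
        · rw [← hr, Category.assoc, Category.assoc, hg]
          rfl
      refine (key y r₁ hr₁ v).trans (Eq.trans ?_ (key z r₂ hr₂ w).symm)
      exact congr_arg (fun x => s.ι.app l (H.map g x)) hE⟩

theorem preservesColimitsOfShape_of_finitary (T : (S → Type u) ⥤ (S → Type u))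
    [PreservesFilteredColimits T] (J : Type u) [SmallCategory J] [IsSifted J] :
    PreservesColimitsOfShape J T where
  preservesColimit {K} := ⟨fun {c} hc => by
    have h (s : S) : PreservesColimitsOfShape J (T ⋙ Pi.eval (fun _ : S => Type u) s) :=
      have : PreservesFilteredColimits (T ⋙ Pi.eval (fun _ : S => Type u) s) :=
        ⟨fun I _ _ =>
          have := PreservesFilteredColimitsOfSize.preserves_filtered_colimits (F := T) I
          inferInstance⟩
      preservesColimitsOfShape_of_preservesFilteredColimits _ J
    exact ⟨pi.coconeOfCoconeEvalIsColimit (F := K ⋙ T)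
      (c := fun s => (T ⋙ Pi.eval (fun _ : S => Type u) s).mapCocone c) fun s =>
      isColimitOfPreserves (T ⋙ Pi.eval (fun _ : S => Type u) s) hc⟩⟩

end Finitary

/-! ### Free finitely generated algebras are perfectly presentable -/

section Algebras

variable {S : Type u} {T : Monad (S → Type u)} [PreservesFilteredColimits T.toFunctor]

theorem preservesColimitsOfShape_forget (J : Type u) [SmallCategory J] [IsSifted J] :
    PreservesColimitsOfShape J T.forget := by
  have := preservesColimitsOfShape_of_finitary T.toFunctor J
  have : HasColimitsOfShape J (S → Type u) :=
    ⟨fun K => pi.hasColimit_of_hasColimit_comp_eval⟩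
  infer_instance

theorem preservesColimitsOfShape_coyoneda_of_isFfg {X : T.Algebra} (hX : IsFfg T X)
    (J : Type*) [Category J] [EssentiallySmall.{u} J] [IsSifted J] :
    PreservesColimitsOfShape J (coyoneda.obj (.op X)) := by
  obtain ⟨X₀, h, ⟨i⟩⟩ := hX
  have : IsSifted (SmallModel.{u} J) := IsSifted.isSifted_of_equiv (equivSmallModel J).symm
  have := preservesColimitsOfShape_forget (T := T) (SmallModel.{u} J)
  have := preservesColimitsOfShape_coyoneda_of_finite (J := SmallModel.{u} J) X₀ h
  have e : T.forget ⋙ coyoneda.obj (.op X₀) ≅ coyoneda.obj (.op X) :=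
    NatIso.ofComponents
      (fun A => ((T.adj.homEquiv X₀ A).symm.trans
        (i.homCongr (Iso.refl A)).symm).toIso)
      (fun f => by
        ext g
        have := T.adj.homEquiv_naturality_right_symm g f
        exact congr_arg (i.hom ≫ ·) this)
  have := preservesColimitsOfShape_of_natIso (J := SmallModel.{u} J) e
  exact preservesColimitsOfShape_of_equiv (equivSmallModel J).symm _

end Algebras

/-! ### Connected colimits and coproducts with a constant -/

section Connected

variable {C : Type*} [Category C] [HasBinaryCoproducts C]

/-- The functor `Z + (-)` preserves connected colimits. -/
instance preservesColimitsOfShape_coprod (Z : C) (J : Type*) [Category J] [IsConnected J] :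
    PreservesColimitsOfShape J (coprod.functor.obj Z) where
  preservesColimit {K} := ⟨fun {c} hc => by
    let j₀ : J := Classical.arbitrary J
    obtain ⟨a, ha⟩ : ∃ a : ∀ (s : Cocone (K ⋙ coprod.functor.obj Z)) j, Z ⨿ K.obj j ⟶ s.pt,
      ∀ s j, a s j = s.ι.app j := ⟨fun s j => s.ι.app j, fun _ _ => rfl⟩
    obtain ⟨b, hb⟩ : ∃ b : ∀ j, K.obj j ⟶ c.pt, ∀ j, b j = c.ι.app j :=
      ⟨fun j => c.ι.app j, fun _ => rfl⟩
    have hB (j : J) : ((coprod.functor.obj Z).mapCocone c).ι.app j = coprod.map (𝟙 Z) (b j) := by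
      rw [hb]
      rfl
    have w (s) {i j : J} (v : i ⟶ j) : coprod.map (𝟙 Z) (K.map v) ≫ a s j = a s i := by
      rw [ha, ha]
      exact s.w v
    have hs (s) (j : J) : coprod.inl ≫ a s j = coprod.inl ≫ a s j₀ :=
      constant_of_preserves_morphisms (fun j => coprod.inl ≫ a s j)
        (fun i j v => by simp [← w s v]) j j₀
    have hd (s) : ∃ d : c.pt ⟶ s.pt, ∀ j, b j ≫ d = coprod.inr ≫ a s j :=
      let r : Cocone K :=
        { pt := s.pt
          ι :=
            { app := fun j => coprod.inr ≫ a s j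
              naturality := fun i j v => by simp [← w s v] } }
      ⟨hc.desc r, fun j => by
        rw [hb]
        exact hc.fac r j⟩
    choose d hd using hd
    have fac (s) (j : J) :
        coprod.map (𝟙 Z) (b j) ≫ coprod.desc (coprod.inl ≫ a s j₀) (d s) = a s j := by
      ext
      · simp [hs s j, coprod.inl_desc]
      · simp [hd, coprod.inr_desc]
    refine ⟨IsColimit.ofExistsUnique fun s =>
      ⟨coprod.desc (coprod.inl ≫ a s j₀) (d s), fun j => ?_, fun m hm => ?_⟩⟩
    · exact (congr_arg (· ≫ _) (hB j)).trans ((fac s j).trans (ha s j))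
    · obtain ⟨m, rfl⟩ : ∃ m' : Z ⨿ c.pt ⟶ s.pt, m' = m := ⟨m, rfl⟩
      have hm (j : J) : coprod.map (𝟙 Z) (b j) ≫ m = a s j :=
        ((congr_arg (· ≫ m) (hB j)).symm.trans (hm j)).trans (ha s j).symm
      have uniq : m = coprod.desc (coprod.inl ≫ a s j₀) (d s) := by
        refine coprod.hom_ext ?_ (hc.hom_ext fun j => ?_)
        · simp [← hm j₀, coprod.inl_desc]
        · rw [coprod.inr_desc, ← hb, hd, ← hm j]
          simp
      exact uniq⟩

theorem preservesColimitsOfShape_plusConst (F : C ⥤ C) (Y : C) (J : Type*) [Category J]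
    [IsConnected J] [PreservesColimitsOfShape J F] :
    PreservesColimitsOfShape J (plusConst F Y) :=
  preservesColimitsOfShape_of_natIso (F := F ⋙ coprod.functor.obj Y)
    (NatIso.ofComponents (fun X => coprod.braiding Y (F.obj X))
      (fun {A B} f => by
        change coprod.map (𝟙 Y) (F.map f) ≫ (coprod.braiding Y (F.obj B)).hom =
          (coprod.braiding Y (F.obj A)).hom ≫ coprod.map (F.map f) (𝟙 Y)
        simp))

end Connected

/-! ### Colimits of coalgebras -/

section Coalgebras

variable {C : Type*} [Category C] {G : C ⥤ C} {J : Type*} [Category J]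

open Endofunctor

/-- The compatible family formed by the structures of a diagram of coalgebras and a cocone on the
carriers. -/
def strCocone (K : J ⥤ Coalgebra G) (t : Cocone (K ⋙ Coalgebra.forget G)) :
    Cocone (K ⋙ Coalgebra.forget G) where
  pt := G.obj t.pt
  ι :=
    { app := fun j => (K.obj j).str ≫ G.map (t.ι.app j)
      naturality := fun i j v => by
        have w : (K.map v).f ≫ t.ι.app j = t.ι.app i := t.w v
        have h : (K.map v).f ≫ (K.obj j).str ≫ G.map (t.ι.app j) =
            (K.obj i).str ≫ G.map (t.ι.app i) := by
          rw [← w, ← Coalgebra.Hom.h_assoc]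
          exact congr_arg _ (G.map_comp _ _).symm
        exact h.trans (Category.comp_id _).symm }

/-- The coalgebra structure on a colimit of carriers of coalgebras. -/
def coalgebraCocone (K : J ⥤ Coalgebra G) {t : Cocone (K ⋙ Coalgebra.forget G)}
    (ht : IsColimit t) : Cocone K where
  pt := { V := t.pt, str := ht.desc (strCocone K t) }
  ι :=
    { app := fun j => { f := t.ι.app j, h := (ht.fac (strCocone K t) j).symm }
      naturality := fun _ _ v => Coalgebra.ext (t.ι.naturality v) }

/-- Colimits of coalgebras are formed in the base category. -/
def coalgebraCoconeIsColimit (K : J ⥤ Coalgebra G) {t : Cocone (K ⋙ Coalgebra.forget G)}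
    (ht : IsColimit t) : IsColimit (coalgebraCocone K ht) where
  desc s :=
    { f := ht.desc ((Coalgebra.forget G).mapCocone s)
      h := by
        refine ht.hom_ext fun j => ?_
        have h₁ : t.ι.app j ≫ ht.desc ((Coalgebra.forget G).mapCocone s) = (s.ι.app j).f :=
          ht.fac ((Coalgebra.forget G).mapCocone s) j
        refine (ht.fac_assoc (strCocone K t) j _).trans ?_
        refine Eq.trans ?_ ((s.ι.app j).h.trans (ht.fac_assoc
          ((Coalgebra.forget G).mapCocone s) j s.pt.str).symm)
        refine (Category.assoc _ _ _).trans (congr_arg _ ?_)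
        exact (G.map_comp _ _).symm.trans (congr_arg G.map h₁) }
  fac s j := Coalgebra.ext (ht.fac ((Coalgebra.forget G).mapCocone s) j)
  uniq s m hm := Coalgebra.ext
    (ht.uniq ((Coalgebra.forget G).mapCocone s) m.f fun j => congr_arg Coalgebra.Hom.f (hm j))

instance hasColimitsOfShape_coalgebra [HasColimitsOfShape J C] :
    HasColimitsOfShape J (Coalgebra G) where
  has_colimit K := ⟨⟨⟨_, coalgebraCoconeIsColimit K
    (colimit.isColimit (K ⋙ Coalgebra.forget G))⟩⟩⟩

instance preservesColimitsOfShape_coalgebra_forget [HasColimitsOfShape J C] :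
    PreservesColimitsOfShape J (Coalgebra.forget G) where
  preservesColimit {K} := preservesColimit_of_preserves_colimit_cocone
    (coalgebraCoconeIsColimit K (colimit.isColimit (K ⋙ Coalgebra.forget G)))
    (colimit.isColimit (K ⋙ Coalgebra.forget G))

/-- Coalgebras with carrier in `P`. -/
abbrev CoalgebraIn (P : ObjectProperty C) (G : C ⥤ C) :=
  ObjectProperty.FullSubcategory (fun c : Coalgebra G => P c.V)

instance hasBinaryCoproducts_coalgebraIn [HasBinaryCoproducts C] (P : ObjectProperty C)
    [P.IsClosedUnderBinaryCoproducts] (G : C ⥤ C) : HasBinaryCoproducts (CoalgebraIn P G) :=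
  have : (P.inverseImage (Coalgebra.forget G)).IsClosedUnderBinaryCoproducts := inferInstance
  hasColimitsOfShape_of_closedUnderColimits (J := Discrete WalkingPair)
    (P := P.inverseImage (Coalgebra.forget G))

end Coalgebras

section FfgCoalgebras

variable {S : Type u} {T : Monad (S → Type u)}

open Endofunctor

instance isSifted_coalgebraIn_isFfg (G : T.Algebra ⥤ T.Algebra) :
    IsSifted (CoalgebraIn (IsFfg T) G) :=
  have : Nonempty (CoalgebraIn (IsFfg T) G) := by
    let X : S → Type u := fun _ => PEmpty
    exact ⟨⟨⟨T.free.obj X, (T.adj.homEquiv X _).symm fun s => TypeCat.ofHom PEmpty.elim⟩, X,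
      Finite.of_injective (β := Empty) (fun p => p.2.elim) fun p => p.2.elim, ⟨Iso.refl _⟩⟩⟩
  inferInstance

/-- The finite sorted set given by a finite sequence of sorts. -/
def ofSorts {n : ℕ} (σ : Fin n → S) : S → Type u := fun s => ULift {i // σ i = s}

theorem exists_iso_ofSorts (X : S → Type u) [Finite (Σ s, X s)] :
    ∃ (n : ℕ) (σ : Fin n → S), Nonempty (X ≅ ofSorts σ) := by
  obtain ⟨n, ⟨e⟩⟩ := Finite.exists_equiv_fin (Σ s, X s)
  refine ⟨n, fun i => (e.symm i).1, ⟨Pi.isoMk fun s => Equiv.toIso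
    { toFun := fun x => ⟨e ⟨s, x⟩, congr_arg Sigma.fst (e.symm_apply_apply _)⟩
      invFun := fun i => cast (congr_arg X i.down.2) (e.symm i.down.1).2
      left_inv := fun x => ?_
      right_inv := ?_ }⟩⟩
  · refine eq_of_heq ((cast_heq _ _).trans ?_)
    dsimp only
    rw [e.symm_apply_apply]
  · rintro ⟨i, rfl⟩
    exact congr_arg ULift.up (Subtype.ext (e.apply_symm_apply i))

/-- Up to isomorphism, a coalgebra with ffg carrier is given by a finite sequence of sorts and a
coalgebra structure on the corresponding free algebra. -/
instance essentiallySmall_coalgebraIn_isFfg (G : T.Algebra ⥤ T.Algebra) :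
    EssentiallySmall.{u} (CoalgebraIn (IsFfg T) G) := by
  rw [essentiallySmall_iff]
  refine ⟨?_, inferInstance⟩
  have hfin {n : ℕ} (σ : Fin n → S) : Finite (Σ s, ofSorts σ s) :=
    Finite.of_injective (β := Fin n) (fun p => p.2.down.1) (by
      rintro ⟨s, i, rfl⟩ ⟨t, j, rfl⟩ h
      dsimp only at h
      subst h
      rfl)
  let R : Type u := Σ (n : ℕ) (σ : Fin n → S),
    T.free.obj (ofSorts σ) ⟶ G.obj (T.free.obj (ofSorts σ))
  let φ (r : R) : CoalgebraIn (IsFfg T) G := ⟨⟨_, r.2.2⟩, _, hfin r.2.1, ⟨Iso.refl _⟩⟩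
  refine small_of_surjective (α := R) (f := fun r => toSkeleton (φ r)) fun x => ?_
  obtain ⟨X, hX, ⟨i⟩⟩ := ((fromSkeleton _).obj x).property
  obtain ⟨n, σ, ⟨j⟩⟩ := exists_iso_ofSorts X
  let k := i ≪≫ T.free.mapIso j
  refine ⟨⟨n, σ, k.inv ≫ ((fromSkeleton _).obj x).obj.str ≫ G.map k.hom⟩, ?_⟩
  refine Eq.trans ?_ (toSkeleton_fromSkeleton_obj x)
  rw [toSkeleton_eq_toSkeleton_iff]
  exact ⟨(ObjectProperty.isoMk _ (Coalgebra.isoMk k (by simp [φ]))).symm⟩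

end FfgCoalgebras

/-! ### The colimit of the coalgebras with carrier in a class of objects -/

section Canonical

open Endofunctor

section Legs

variable {C : Type*} [Category.{u} C] {P : ObjectProperty C}
  {G : C ⥤ C} (Φ : Cocone (coalgebraInclusion P G)) {V W : C}

/-- The component of the cocone `Φ` at the coalgebra `(V, s)`. -/
def leg (s : V ⟶ G.obj V) (hV : P V) : V ⟶ Φ.pt.V :=
  component Φ ⟨V, s⟩ hV

variable {Φ}

theorem comp_leg {s : V ⟶ G.obj V} {t : W ⟶ G.obj W} (hV : P V) (hW : P W) (m : V ⟶ W)
    (hm : s ≫ G.map m = m ≫ t) : m ≫ leg Φ t hW = leg Φ s hV :=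
  let f : (⟨⟨V, s⟩, hV⟩ : CoalgebraIn P G) ⟶ ⟨⟨W, t⟩, hW⟩ := ObjectProperty.homMk ⟨m, hm⟩
  congr_arg Coalgebra.Hom.f (Φ.w f)

theorem leg_str (s : V ⟶ G.obj V) (hV : P V) :
    leg Φ s hV ≫ Φ.pt.str = s ≫ G.map (leg Φ s hV) :=
  (Φ.ι.app ⟨⟨V, s⟩, hV⟩).h.symm

variable [HasColimitsOfShape (CoalgebraIn P G) C] (hΦ : IsColimit Φ)

include hΦ

/-- The carrier of `Φ` is the colimit of the carriers. -/
noncomputable def carrierIsColimit : IsColimit ((Coalgebra.forget G).mapCocone Φ) :=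
  isColimitOfPreserves (Coalgebra.forget G) hΦ

theorem hom_ext_leg {A : C} {f g : Φ.pt.V ⟶ A}
    (h : ∀ (V : C) (s : V ⟶ G.obj V) (hV : P V), leg Φ s hV ≫ f = leg Φ s hV ≫ g) : f = g :=
  (carrierIsColimit hΦ).hom_ext fun c => h c.obj.V c.obj.str c.property

theorem exists_desc_leg {A : C} (q : ∀ (V : C) (_ : V ⟶ G.obj V) (_ : P V), V ⟶ A)
    (hq : ∀ (V W : C) (s : V ⟶ G.obj V) (t : W ⟶ G.obj W) (hV : P V) (hW : P W) (m : V ⟶ W),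
      s ≫ G.map m = m ≫ t → m ≫ q W t hW = q V s hV) :
    ∃ p : Φ.pt.V ⟶ A, ∀ (V : C) (s : V ⟶ G.obj V) (hV : P V), leg Φ s hV ≫ p = q V s hV := by
  let t : Cocone (coalgebraInclusion P G ⋙ Coalgebra.forget G) :=
    { pt := A
      ι :=
        { app := fun c => q c.obj.V c.obj.str c.property
          naturality := fun c d f =>
            (hq _ _ _ _ c.property d.property f.hom.f f.hom.h).trans (Category.comp_id _).symm } }
  exact ⟨(carrierIsColimit hΦ).desc t, fun V s hV =>
    (carrierIsColimit hΦ).fac t ⟨⟨V, s⟩, hV⟩⟩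

variable {X : C} [PreservesColimitsOfShape (CoalgebraIn P G) (coyoneda.obj (.op X))]

theorem exists_leg (f : X ⟶ Φ.pt.V) :
    ∃ (V : C) (s : V ⟶ G.obj V) (hV : P V) (g : X ⟶ V), g ≫ leg Φ s hV = f := by
  obtain ⟨c, g, hg⟩ := exists_hom_of_isColimit (carrierIsColimit hΦ) f
  exact ⟨c.obj.V, c.obj.str, c.property, g, hg⟩

variable (H : C ⥤ C) [PreservesColimitsOfShape (CoalgebraIn P G) H]

theorem exists_map_leg (f : X ⟶ H.obj Φ.pt.V) :
    ∃ (V : C) (s : V ⟶ G.obj V) (hV : P V) (g : X ⟶ H.obj V), g ≫ H.map (leg Φ s hV) = f := by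
  obtain ⟨c, g, hg⟩ := exists_hom_of_isColimit
    (isColimitOfPreserves H (carrierIsColimit hΦ)) f
  exact ⟨c.obj.V, c.obj.str, c.property, g, hg⟩

/-- Morphisms into the objects `HV`, for coalgebras `V`, that become equal in `HΦ` are not
distinguished by an assignment that is invariant under coalgebra morphisms. -/
theorem eq_of_comp_map_leg_eq {β : Type u}
    (Ψ : ∀ (V : C) (_ : V ⟶ G.obj V) (_ : P V), (X ⟶ H.obj V) → β)
    (hΨ : ∀ (V W : C) (s : V ⟶ G.obj V) (t : W ⟶ G.obj W) (hV : P V) (hW : P W) (m : V ⟶ W),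
      s ≫ G.map m = m ≫ t → ∀ f : X ⟶ H.obj V, Ψ W t hW (f ≫ H.map m) = Ψ V s hV f)
    {s : V ⟶ G.obj V} {t : W ⟶ G.obj W} {hV : P V} {hW : P W} {f : X ⟶ H.obj V}
    {g : X ⟶ H.obj W} (h : f ≫ H.map (leg Φ s hV) = g ≫ H.map (leg Φ t hW)) :
    Ψ V s hV f = Ψ W t hW g :=
  eq_of_comp_ι_eq (isColimitOfPreserves H (carrierIsColimit hΦ))
    (fun c f => Ψ c.obj.V c.obj.str c.property f)
    (fun c d m f => hΨ _ _ _ _ c.property d.property m.hom.f m.hom.h f)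
    (j := ⟨⟨V, s⟩, hV⟩) (k := ⟨⟨W, t⟩, hW⟩) h

end Legs

variable {C : Type*} [Category.{u} C] [HasBinaryCoproducts C] {P : ObjectProperty C}
  {G : C ⥤ C} {Φ : Cocone (coalgebraInclusion P G)} {X V W : C}

/-- The coalgebra structure on `X + V` given by a coalgebra `V ⟶ GV` and a morphism `X ⟶ GV`. -/
noncomputable def extendStr (s : V ⟶ G.obj V) (w : X ⟶ G.obj V) : X ⨿ V ⟶ G.obj (X ⨿ V) :=
  coprod.desc w s ≫ G.map coprod.inr

/-- The structure of the coalgebra `w ▪ c` for `c = (V, s)`. -/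
noncomputable def combineStr (s : V ⟶ G.obj V) (w : X ⟶ G.obj X ⨿ V) :
    X ⨿ V ⟶ G.obj (X ⨿ V) :=
  coprod.desc w coprod.inr ≫ coprod.map (𝟙 (G.obj X)) s ≫ can G X V

theorem combineStr_eq (s : V ⟶ G.obj V) (w : X ⟶ G.obj X ⨿ V) :
    combineStr s w =
      coprod.desc (w ≫ coprod.desc (G.map coprod.inl) (s ≫ G.map coprod.inr))
        (s ≫ G.map coprod.inr) := by
  simp only [combineStr, can]
  ext <;> simp [coprod.inl_desc, coprod.inr_desc]

theorem combine_eq {Z : C} (e : X ⟶ G.obj X ⨿ V) (f : V ⟶ G.obj V ⨿ Z) :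
    combine e f =
      coprod.desc (e ≫ coprod.desc (G.map coprod.inl ≫ coprod.inl)
        (f ≫ coprod.map (G.map coprod.inr) (𝟙 Z))) (f ≫ coprod.map (G.map coprod.inr) (𝟙 Z)) := by
  have h : coprod.map (𝟙 (G.obj X)) f ≫ (coprod.associator (G.obj X) (G.obj V) Z).inv ≫
      coprod.map (can G X V) (𝟙 Z) = coprod.desc (G.map coprod.inl ≫ coprod.inl)
        (f ≫ coprod.map (G.map coprod.inr) (𝟙 Z)) := by
    have h' : (coprod.associator (G.obj X) (G.obj V) Z).inv ≫ coprod.map (can G X V) (𝟙 Z) =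
        coprod.desc (G.map coprod.inl ≫ coprod.inl) (coprod.map (G.map coprod.inr) (𝟙 Z)) := by
      simp only [can]
      ext <;> simp [coprod.inl_desc, coprod.inr_desc]
    rw [h', coprod.map_desc, Category.id_comp]
  rw [combine, h, coprod.desc_comp, coprod.inr_desc]

theorem desc_comp_leg_extendStr {s : V ⟶ G.obj V} {t : W ⟶ G.obj W} (hW : P W)
    (w : X ⟶ G.obj V) (h : P (X ⨿ V)) (p : X ⟶ W) (q : V ⟶ W)
    (hp : w ≫ G.map q = p ≫ t) (hq : s ≫ G.map q = q ≫ t) :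
    coprod.desc p q ≫ leg Φ t hW = leg Φ (extendStr s w) h := by
  refine comp_leg h hW _ ?_
  rw [extendStr, Category.assoc, ← G.map_comp, coprod.inr_desc, coprod.desc_comp,
    coprod.desc_comp, hp, hq]

theorem desc_comp_leg_combineStr {s : V ⟶ G.obj V} {t : W ⟶ G.obj W} (hW : P W)
    (w : X ⟶ G.obj X ⨿ V) (h : P (X ⨿ V)) (p : X ⟶ W) (q : V ⟶ W)
    (hp : w ≫ coprod.desc (G.map p) (s ≫ G.map q) = p ≫ t)
    (hq : s ≫ G.map q = q ≫ t) :
    coprod.desc p q ≫ leg Φ t hW = leg Φ (combineStr s w) h := by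
  refine comp_leg h hW _ ?_
  rw [combineStr_eq, coprod.desc_comp, coprod.desc_comp, Category.assoc, Category.assoc,
    coprod.desc_comp, Category.assoc, ← G.map_comp, ← G.map_comp, coprod.inr_desc,
    coprod.inl_desc, hp, hq]

/-- A coalgebra morphism `[p, q]` from `w ▪ c` to `(W, t)` computes `(w ▪ c)♯ ⬝ inl`. -/
theorem inl_leg_combineStr {s : V ⟶ G.obj V} {t : W ⟶ G.obj W} (hW : P W)
    (w : X ⟶ G.obj X ⨿ V) (h : P (X ⨿ V)) (p : X ⟶ W) (q : V ⟶ W)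
    (hp : w ≫ coprod.desc (G.map p) (s ≫ G.map q) = p ≫ t)
    (hq : s ≫ G.map q = q ≫ t) :
    coprod.inl ≫ leg Φ (combineStr s w) h = p ≫ leg Φ t hW := by
  rw [← desc_comp_leg_combineStr hW w h p q hp hq, coprod.inl_desc_assoc]

theorem inr_leg_combineStr {s : V ⟶ G.obj V} (hV : P V) (w : X ⟶ G.obj X ⨿ V)
    (h : P (X ⨿ V)) : coprod.inr ≫ leg Φ (combineStr s w) h = leg Φ s hV :=
  comp_leg hV h _ (by rw [combineStr_eq, coprod.inr_desc])

theorem inr_leg_extendStr {s : V ⟶ G.obj V} (hV : P V) (w : X ⟶ G.obj V)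
    (h : P (X ⨿ V)) : coprod.inr ≫ leg Φ (extendStr s w) h = leg Φ s hV :=
  comp_leg hV h _ (by rw [extendStr, coprod.inr_desc_assoc])

theorem inl_leg_extendStr_str {s : V ⟶ G.obj V} (hV : P V) (w : X ⟶ G.obj V)
    (h : P (X ⨿ V)) :
    (coprod.inl ≫ leg Φ (extendStr s w) h) ≫ Φ.pt.str = w ≫ G.map (leg Φ s hV) := by
  rw [Category.assoc, leg_str, ← inr_leg_extendStr hV w h, G.map_comp]
  nth_rw 1 [extendStr]
  rw [Category.assoc, coprod.inl_desc_assoc]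

/-- The morphism `(w ▪ c)♯ ⬝ inl` solves the equation `(GX + c♯) ⬝ w`. -/
theorem inl_leg_combineStr_str {s : V ⟶ G.obj V} (hV : P V) (w : X ⟶ G.obj X ⨿ V)
    (h : P (X ⨿ V)) :
    (coprod.inl ≫ leg Φ (combineStr s w) h) ≫ Φ.pt.str =
      w ≫ coprod.desc (G.map (coprod.inl ≫ leg Φ (combineStr s w) h))
        (leg Φ s hV ≫ Φ.pt.str) := by
  rw [Category.assoc, leg_str, leg_str, G.map_comp, ← inr_leg_combineStr hV w h, G.map_comp]
  nth_rw 1 [combineStr_eq]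
  rw [coprod.inl_desc_assoc, Category.assoc, coprod.desc_comp, Category.assoc]

/-! ### Canonical solutions -/

theorem exists_eq_comp_map_leg [IsConnected (CoalgebraIn P G)]
    [HasColimitsOfShape (CoalgebraIn P G) C]
    [PreservesColimitsOfShape (CoalgebraIn P G) (coyoneda.obj (.op X))] (hΦ : IsColimit Φ)
    {A : C} (e : X ⟶ A ⨿ Φ.pt.V) :
    ∃ (V : C) (s : V ⟶ G.obj V) (hV : P V) (w : X ⟶ A ⨿ V),
      e = w ≫ coprod.map (𝟙 A) (leg Φ s hV) := by
  obtain ⟨V, s, hV, w, hw⟩ := exists_map_leg hΦ (coprod.functor.obj A) e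
  exact ⟨V, s, hV, w, hw.symm⟩

variable [P.IsClosedUnderBinaryCoproducts]

/-- The morphism `(w ▪ c)♯ ⬝ inl` is invariant under morphisms of the data `(w, c)`. -/
theorem inl_leg_combineStr_naturality {Z : C} {s : V ⟶ G.obj V} {t : W ⟶ G.obj W} (hX : P X)
    (hZ : P Z) (hV : P V) (hW : P W) (m : X ⟶ Z) (f : V ⟶ W) (hf : s ≫ G.map f = f ≫ t)
    (w : X ⟶ G.obj X ⨿ V) (v : Z ⟶ G.obj Z ⨿ W)
    (hm : w ≫ coprod.map (G.map m) f = m ≫ v) :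
    coprod.inl ≫ leg Φ (combineStr s w) (P.prop_coprod X V hX hV) =
      m ≫ coprod.inl ≫ leg Φ (combineStr t v) (P.prop_coprod Z W hZ hW) := by
  rw [← Category.assoc]
  refine inl_leg_combineStr _ w _ (m ≫ coprod.inl) (f ≫ coprod.inr) ?_ ?_
  · rw [combineStr_eq, Category.assoc, coprod.inl_desc, ← reassoc_of% hm, coprod.map_desc,
      G.map_comp, G.map_comp, reassoc_of% hf]
  · rw [combineStr_eq, Category.assoc, coprod.inr_desc, G.map_comp, reassoc_of% hf]

theorem IsCanonicalSolution.sol_eq {sol : SolutionOperation P G Φ.pt.V}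
    (hsol : IsCanonicalSolution Φ sol) (hX : P X) {s : V ⟶ G.obj V} (hV : P V)
    (w : X ⟶ G.obj X ⨿ V) :
    sol hX (w ≫ coprod.map (𝟙 _) (leg Φ s hV)) =
      coprod.inl ≫ leg Φ (combineStr s w) (P.prop_coprod X V hX hV) :=
  (hsol hX _).2 ⟨V, s⟩ hV w rfl

variable [IsConnected (CoalgebraIn P G)] [HasColimitsOfShape (CoalgebraIn P G) C]
  (hP : ∀ ⦃X : C⦄, P X → PreservesColimitsOfShape (CoalgebraIn P G) (coyoneda.obj (.op X)))
  (hΦ : IsColimit Φ)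

include hP hΦ

theorem exists_isCanonicalSolution :
    ∃ sol : SolutionOperation P G Φ.pt.V, IsCanonicalSolution Φ sol := by
  have hfac (X : C) (hX : P X) (e : X ⟶ G.obj X ⨿ Φ.pt.V) :=
    have := hP hX
    exists_eq_comp_map_leg hΦ e
  choose V s hV w hw using hfac
  refine ⟨fun X hX e => coprod.inl ≫ leg Φ (combineStr (s X hX e) (w X hX e))
    (P.prop_coprod X _ hX (hV X hX e)), fun X hX e =>
    ⟨⟨⟨V X hX e, s X hX e⟩, hV X hX e, w X hX e, hw X hX e⟩, fun c hc v hv => ?_⟩⟩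
  have := hP hX
  -- two factorizations of `e` become equal in the colimit `GX + Φ`
  exact eq_of_comp_map_leg_eq hΦ (coprod.functor.obj (G.obj X))
    (fun V s hV w => coprod.inl ≫ leg Φ (combineStr s w) (P.prop_coprod X V hX hV))
    (fun V W s t hV hW m hm (w : X ⟶ G.obj X ⨿ V) => by
      have := inl_leg_combineStr_naturality (Φ := Φ) hX hX hV hW (𝟙 X) m hm w
        (w ≫ coprod.map (𝟙 _) m) (by rw [G.map_id, Category.id_comp])
      rw [Category.id_comp] at this
      exact this.symm)
    (s := s X hX e) (t := c.str) ((hw X hX e).symm.trans hv)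

omit [IsConnected (CoalgebraIn P G)] in
/-- The structure of `Φ` is invertible: morphisms `X ⟶ GΦ` with `X` in `P` lift uniquely along it.
A lift of `w ⬝ Gc♯` is obtained by extending `c` by `w`, and the extension retracts onto `c` if `w`
factors through the structure of `c`, which yields uniqueness. -/
theorem isIso_str [PreservesColimitsOfShape (CoalgebraIn P G) G] (hdet : P.IsDetecting) :
    IsIso Φ.pt.str := by
  refine hdet _ fun X hX f => ?_
  have := hP hX
  obtain ⟨V, s, hV, w, hw⟩ := exists_map_leg hΦ G f
  refine ⟨coprod.inl ≫ leg Φ (extendStr s w) (P.prop_coprod X V hX hV),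
    (inl_leg_extendStr_str hV w _).trans hw, fun g hg => ?_⟩
  obtain ⟨W, t, hW, x, rfl⟩ := exists_leg hΦ g
  have h₁ : x ≫ leg Φ t hW =
      coprod.inl ≫ leg Φ (extendStr t (x ≫ t)) (P.prop_coprod X W hX hW) := by
    rw [← desc_comp_leg_extendStr (t := t) hW (x ≫ t) (P.prop_coprod X W hX hW) x (𝟙 W)
      (by simp) (by simp), coprod.inl_desc_assoc]
  rw [h₁]
  refine eq_of_comp_map_leg_eq hΦ G
    (fun V s hV w => coprod.inl ≫ leg Φ (extendStr s w) (P.prop_coprod X V hX hV))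
    (fun V W s t hV hW m hm w => ?_) (hV := hW) (hW := hV) ?_
  · have := desc_comp_leg_extendStr (Φ := Φ) (s := s) (t := extendStr t (w ≫ G.map m))
      (P.prop_coprod X W hX hW) w (P.prop_coprod X V hX hV) coprod.inl (m ≫ coprod.inr)
      (by rw [extendStr, coprod.inl_desc_assoc, G.map_comp, Category.assoc])
      (by rw [extendStr, Category.assoc, coprod.inr_desc_assoc, G.map_comp, reassoc_of% hm])
    rw [← this, coprod.inl_desc_assoc]
  · rw [hw, ← hg, Category.assoc, Category.assoc, leg_str]

theorem isElgot_of_isCanonicalSolution [IsIso Φ.pt.str] {sol : SolutionOperation P G Φ.pt.V}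
    (hsol : IsCanonicalSolution Φ sol) : IsElgot P G (inv Φ.pt.str) sol where
  isSolution X hX e := by
    have := hP hX
    obtain ⟨V, s, hV, w, rfl⟩ := exists_eq_comp_map_leg hΦ e
    have h := inl_leg_combineStr_str (Φ := Φ) (s := s) hV w (P.prop_coprod X V hX hV)
    rw [IsSolution, ← cancel_mono Φ.pt.str, hsol.sol_eq, h]
    simp only [Category.assoc, coprod.map_desc, coprod.desc_comp,
      Category.id_comp, Category.comp_id, IsIso.inv_hom_id]
  weakFunctoriality X Y Z hX hY hZ e f m hm h := by
    have := hP hZ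
    obtain ⟨V, s, hV, z, rfl⟩ := exists_leg hΦ h
    have hr {W : C} (g : W ⟶ G.obj W ⨿ Z) : rename (z ≫ leg Φ s hV) g =
        rename z g ≫ coprod.map (𝟙 _) (leg Φ s hV) := by simp [rename]
    rw [hr, hr, hsol.sol_eq, hsol.sol_eq]
    refine (inl_leg_combineStr_naturality hX hY hV hV m (𝟙 V) (by simp) (rename z e)
      (rename z f) ?_).symm
    simp only [rename, ← reassoc_of% hm]
    simp
  compositionality X Y hX hY e f := by
    have := hP hY
    obtain ⟨V, s, hV, w, rfl⟩ := exists_eq_comp_map_leg hΦ f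
    have h₁ : rename (coprod.inl ≫ leg Φ (combineStr s w) (P.prop_coprod Y V hY hV)) e =
        rename coprod.inl e ≫
          coprod.map (𝟙 _) (leg Φ (combineStr s w) (P.prop_coprod Y V hY hV)) := by
      simp [rename]
    have h₂ : combine e (w ≫ coprod.map (𝟙 _) (leg Φ s hV)) =
        combine e w ≫ coprod.map (𝟙 _) (leg Φ s hV) := by
      simp only [combine]
      ext <;> simp
    rw [hsol.sol_eq, h₁, h₂, hsol.sol_eq, hsol.sol_eq, ← Category.assoc]
    -- the associativity isomorphism is a morphism of coalgebras
    have hl : G.map coprod.inl ≫ G.map (coprod.map coprod.inr (𝟙 V)) =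
        G.map (coprod.inr : Y ⟶ X ⨿ Y) ≫ G.map coprod.inl := by
      rw [← G.map_comp, coprod.inl_map, G.map_comp]
    have hr : G.map coprod.inr ≫ G.map (coprod.map (coprod.inr : Y ⟶ X ⨿ Y) (𝟙 V)) =
        G.map coprod.inr := by
      rw [← G.map_comp, coprod.inr_map, Category.id_comp]
    refine inl_leg_combineStr _ _ _ (coprod.inl ≫ coprod.inl) (coprod.map coprod.inr (𝟙 V)) ?_ ?_
    · simp only [combineStr_eq, combine_eq, rename, Category.assoc, coprod.inl_desc,
        coprod.map_desc, coprod.desc_comp, Category.id_comp, G.map_comp]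
      congr 1
      ext <;> simp [coprod.inl_desc, coprod.inr_desc, hl, hr]
    · simp only [combineStr_eq, combine_eq, coprod.desc_comp, Category.assoc]
      ext <;> simp [coprod.inl_desc, coprod.inr_desc, hl, hr]

end Canonical

/-! ### Elgot algebras for `F` from Elgot algebras for `F(-) + Y` -/

section Induced

variable {C : Type*} [Category C] [HasBinaryCoproducts C] {P : ObjectProperty C}
  [P.IsClosedUnderBinaryCoproducts] {F : C ⥤ C} {Y : C}

theorem plusInl_map {X Z : C} (m : X ⟶ Z) :
    plusInl F Y X ≫ (plusConst F Y).map m = F.map m ≫ plusInl F Y Z :=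
  coprod.inl_map _ _

theorem plusInr_map {X Z : C} (m : X ⟶ Z) :
    plusInr F Y X ≫ (plusConst F Y).map m = plusInr F Y Z :=
  (coprod.inr_map _ _).trans (Category.id_comp _)

variable (Y) in
/-- An equation over `F`, viewed as an equation over `F(-) + Y`. -/
noncomputable def extendEquation {X A : C} (e : X ⟶ F.obj X ⨿ A) :
    X ⟶ (plusConst F Y).obj X ⨿ A :=
  e ≫ coprod.map (plusInl F Y X) (𝟙 A)

theorem extendEquation_rename {X A B : C} (h : A ⟶ B) (e : X ⟶ F.obj X ⨿ A) :
    extendEquation Y (rename h e) = rename h (extendEquation Y e) := by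
  simp [extendEquation, rename]

theorem extendEquation_combine {X Z A : C} (e : X ⟶ F.obj X ⨿ Z) (f : Z ⟶ F.obj Z ⨿ A) :
    extendEquation Y (combine e f) = combine (extendEquation Y e) (extendEquation Y f) := by
  simp only [extendEquation, combine_eq, coprod.desc_comp, Category.assoc, coprod.map_map,
    coprod.map_desc, Category.id_comp, Category.comp_id, plusInl_map, coprod.inl_map,
    reassoc_of% plusInl_map]

theorem IsElgot.inducedSolution {A : C} {a : (plusConst F Y).obj A ⟶ A}
    {sol : SolutionOperation P (plusConst F Y) A} (h : IsElgot P (plusConst F Y) a sol) :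
    IsElgot P F (plusInl F Y A ≫ a) (inducedSolution sol) where
  isSolution X hX e := by
    have := h.isSolution hX (extendEquation Y e)
    rw [IsSolution] at this ⊢
    refine this.trans ?_
    simp only [extendEquation, Category.assoc, coprod.map_desc, Category.comp_id,
      reassoc_of% plusInl_map]
    rfl
  weakFunctoriality X Z W hX hZ hW e f m hm g := by
    have := h.weakFunctoriality hX hZ hW (extendEquation Y e) (extendEquation Y f) m (by
      simp only [extendEquation, Category.assoc, coprod.map_map, ← reassoc_of% hm,
        plusInl_map, Category.comp_id]) g
    rw [← extendEquation_rename, ← extendEquation_rename] at this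
    exact this
  compositionality X Z hX hZ e f := by
    have := h.compositionality hX hZ (extendEquation Y e) (extendEquation Y f)
    rw [← extendEquation_rename, ← extendEquation_combine] at this
    exact this

end Induced

/-! ### Freeness -/

section Free

open Endofunctor

variable {C : Type*} [Category.{u} C] [HasBinaryCoproducts C] {P : ObjectProperty C}
  [P.IsClosedUnderBinaryCoproducts] {F : C ⥤ C} {Y : C}

section Parameters

variable {I : Type u} [SmallCategory I] [IsFiltered I] {D : I ⥤ C} {y : Cocone D}
  (hy : IsColimit y)

include hy

/-- Equations with parameters in a filtered colimit of objects of `P` have, up to renaming,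
parameters in an object of the diagram. -/
theorem exists_rename_ι {X A : C} [PreservesColimitsOfShape I (coyoneda.obj (.op X))]
    (e : X ⟶ F.obj A ⨿ y.pt) :
    ∃ (i : I) (e' : X ⟶ F.obj A ⨿ D.obj i), e = e' ≫ coprod.map (𝟙 _) (y.ι.app i) := by
  have := IsFiltered.isConnected I
  obtain ⟨i, e', h⟩ := exists_hom_of_isColimit
    (isColimitOfPreserves (coprod.functor.obj (F.obj A)) hy) e
  exact ⟨i, e', h.symm⟩

theorem exists_map_eq_map {X A : C} [PreservesColimitsOfShape I (coyoneda.obj (.op X))]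
    {i : I} (f g : X ⟶ F.obj A ⨿ D.obj i)
    (h : f ≫ coprod.map (𝟙 _) (y.ι.app i) = g ≫ coprod.map (𝟙 _) (y.ι.app i)) :
    ∃ (j : I) (v : i ⟶ j),
      f ≫ coprod.map (𝟙 _) (D.map v) = g ≫ coprod.map (𝟙 _) (D.map v) := by
  have := IsFiltered.isConnected I
  exact (Types.FilteredColimit.isColimit_eq_iff'
    (isColimitOfPreserves (coprod.functor.obj (F.obj A) ⋙ coyoneda.obj (.op X)) hy) f g).1 h

/-- Weak functoriality extends to parameter objects that are filtered colimits of objects of `P`. -/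
theorem IsElgot.comp_sol_rename (hP : ∀ ⦃X : C⦄, P X →
      PreservesColimitsOfShape I (coyoneda.obj (.op X))) (hD : ∀ i, P (D.obj i))
    {B : C} {b : F.obj B ⟶ B} {sol : SolutionOperation P F B} (hB : IsElgot P F b sol)
    {X Z : C} (hX : P X) (hZ : P Z) (e : X ⟶ F.obj X ⨿ y.pt) (f : Z ⟶ F.obj Z ⨿ y.pt)
    (m : X ⟶ Z) (hm : e ≫ coprod.map (F.map m) (𝟙 _) = m ≫ f) (h : y.pt ⟶ B) :
    m ≫ sol hZ (rename h f) = sol hX (rename h e) := by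
  have := hP hX
  have := hP hZ
  obtain ⟨i, e, rfl⟩ := exists_rename_ι hy e
  obtain ⟨j, f, rfl⟩ := exists_rename_ι hy f
  -- pass to a common parameter object over which `m` is a morphism of equations
  obtain ⟨k, v, hv⟩ := exists_map_eq_map hy (A := Z)
    (e ≫ coprod.map (F.map m) (D.map (IsFiltered.leftToMax i j)))
    (m ≫ f ≫ coprod.map (𝟙 _) (D.map (IsFiltered.rightToMax i j))) (by
      simpa using hm)
  let v₁ := IsFiltered.leftToMax i j ≫ v
  let v₂ := IsFiltered.rightToMax i j ≫ v
  have h₁ : rename h (e ≫ coprod.map (𝟙 _) (y.ι.app i)) =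
      rename (y.ι.app k ≫ h) (e ≫ coprod.map (𝟙 _) (D.map v₁)) := by
    simp [rename]
  have h₂ : rename h (f ≫ coprod.map (𝟙 _) (y.ι.app j)) =
      rename (y.ι.app k ≫ h) (f ≫ coprod.map (𝟙 _) (D.map v₂)) := by
    simp [rename]
  rw [h₁, h₂]
  refine hB.weakFunctoriality hX hZ (hD k) _ _ m ?_ _
  simpa [v₁, v₂] using hv

end Parameters

/-- A coalgebra structure for `F(-) + Y`, viewed as an equation over `F` with parameters `Y`. -/
def toEquation {V : C} (s : V ⟶ (plusConst F Y).obj V) : V ⟶ F.obj V ⨿ Y := s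

theorem toEquation_combineStr {X V : C} (s : V ⟶ (plusConst F Y).obj V) (w : X ⟶ F.obj X ⨿ V) :
    toEquation (combineStr s (extendEquation Y w)) = combine w (toEquation s) := by
  have h : extendEquation Y w ≫ coprod.desc ((plusConst F Y).map coprod.inl)
      (s ≫ (plusConst F Y).map coprod.inr) =
      w ≫ coprod.desc (F.map coprod.inl ≫ plusInl F Y (X ⨿ V))
        (s ≫ (plusConst F Y).map coprod.inr) := by
    rw [extendEquation, Category.assoc, coprod.map_desc, plusInl_map, Category.id_comp]
  rw [combineStr_eq, combine_eq, h]
  rfl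

theorem rename_combine {X V A B : C} (e : X ⟶ F.obj X ⨿ V) (f : V ⟶ F.obj V ⨿ A)
    (h : A ⟶ B) : rename h (combine e f) = combine e (rename h f) := by
  simp only [rename, combine_eq, coprod.desc_comp, Category.assoc, coprod.map_map,
    Category.id_comp, Category.comp_id, coprod.inl_map]

variable {Φ : Cocone (coalgebraInclusion P (plusConst F Y))} [IsIso Φ.pt.str]

omit [P.IsClosedUnderBinaryCoproducts] in
theorem comp_invRight {X : C} (hX : P X) (x : X ⟶ Y) :
    x ≫ invRight Φ.pt = leg Φ (x ≫ plusInr F Y X) hX := by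
  rw [← cancel_mono Φ.pt.str, leg_str, invRight]
  simp [plusInr_map]

variable {I : Type u} [SmallCategory I] [IsFiltered I] {D : I ⥤ C}
  {y : D ⟶ (Functor.const I).obj Y} {sol : SolutionOperation P (plusConst F Y) Φ.pt.V}

omit [IsIso Φ.pt.str] in
theorem IsCanonicalSolution.inducedSolution_eq (hsol : IsCanonicalSolution Φ sol) {X V : C}
    (hX : P X) {s : V ⟶ (plusConst F Y).obj V} (hV : P V) (w : X ⟶ F.obj X ⨿ V) :
    inducedSolution sol hX (w ≫ coprod.map (𝟙 _) (leg Φ s hV)) =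
      coprod.inl ≫ leg Φ (combineStr s (extendEquation Y w)) (P.prop_coprod X V hX hV) := by
  rw [← hsol.sol_eq hX hV (extendEquation Y w)]
  exact congr_arg (sol hX) (extendEquation_rename (leg Φ s hV) w)

/-- Every coalgebra with carrier in `P`, viewed as an equation with parameters in `Φ`, is solved by
the corresponding component of the colimit. -/
theorem inducedSolution_rename_invRight (hy : IsColimit (Cocone.mk Y y)) (hD : ∀ i, P (D.obj i))
    (hsol : IsCanonicalSolution Φ sol) {V : C} (hV : P V)
    [PreservesColimitsOfShape I (coyoneda.obj (.op V))] (s : V ⟶ (plusConst F Y).obj V) :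
    inducedSolution sol hV (rename (invRight Φ.pt) (toEquation s)) = leg Φ s hV := by
  obtain ⟨Z, hZ, x, w, hw⟩ : ∃ (Z : C) (_ : P Z) (x : Z ⟶ Y) (w : V ⟶ F.obj V ⨿ Z),
      toEquation s = w ≫ coprod.map (𝟙 _) x := by
    obtain ⟨i, w, hw⟩ := exists_rename_ι hy (toEquation s)
    exact ⟨D.obj i, hD i, y.app i, w, hw⟩
  have h : rename (invRight Φ.pt) (toEquation s) =
      w ≫ coprod.map (𝟙 _) (leg Φ (x ≫ plusInr F Y Z) hZ) := by
    rw [← comp_invRight hZ x, hw]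
    simp [rename]
  rw [h, hsol.inducedSolution_eq]
  -- the coalgebra `(V, s)` embeds into the one that defines the canonical solution
  refine comp_leg hV _ _ ?_
  have h' : coprod.desc (F.map coprod.inl ≫ plusInl F Y (V ⨿ Z)) (x ≫ plusInr F Y (V ⨿ Z)) =
      coprod.map (F.map coprod.inl) x :=
    coprod.hom_ext ((coprod.inl_desc _ _).trans (coprod.inl_map _ _).symm)
      ((coprod.inr_desc _ _).trans (coprod.inr_map _ _).symm)
  rw [combineStr_eq, coprod.inl_desc, extendEquation, Category.assoc, coprod.map_desc,
    plusInl_map, Category.id_comp, Category.assoc, plusInr_map, h']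
  refine (congr_arg (· ≫ coprod.map (F.map coprod.inl) (𝟙 Y)) hw).trans ?_
  simp only [Category.assoc, coprod.map_map, Category.id_comp, Category.comp_id]
  rfl

/-- The unique morphism into an Elgot algebra `B` that extends `h` sends the component at a
coalgebra `c` to the solution in `B` of `c`, viewed as an equation with parameters renamed
along `h`. -/
theorem isFreeOn [IsConnected (CoalgebraIn P (plusConst F Y))]
    [HasColimitsOfShape (CoalgebraIn P (plusConst F Y)) C]
    (hP : ∀ ⦃X : C⦄, P X →
      PreservesColimitsOfShape (CoalgebraIn P (plusConst F Y)) (coyoneda.obj (.op X)))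
    (hP' : ∀ ⦃X : C⦄, P X → PreservesColimitsOfShape I (coyoneda.obj (.op X)))
    (hy : IsColimit (Cocone.mk Y y)) (hD : ∀ i, P (D.obj i)) (hΦ : IsColimit Φ)
    (hsol : IsCanonicalSolution Φ sol)
    (hE : IsElgot P F (invLeft Φ.pt) (inducedSolution sol)) :
    IsFreeOn ⟨Φ.pt.V, invLeft Φ.pt, inducedSolution sol, hE⟩ (invRight Φ.pt) := by
  intro B h
  obtain ⟨p, hp⟩ := exists_desc_leg hΦ
    (fun V s hV => B.sol hV (rename h (toEquation s)))
    (fun V W s t hV hW m hm =>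
      IsElgot.comp_sol_rename hy hP' hD B.isElgot hV hW (toEquation s) (toEquation t) m hm h)
  refine ⟨⟨p, fun X hX e => ?_⟩, ?_, fun p' hp' => ?_⟩
  · have := hP hX
    dsimp only at e ⊢
    obtain ⟨V, s, hV, w, rfl⟩ := exists_eq_comp_map_leg hΦ e
    have h₁ : rename p (w ≫ coprod.map (𝟙 (F.obj X)) (leg Φ s hV)) =
        rename (B.sol hV (rename h (toEquation s))) w := by
      rw [← hp V s hV]
      simp [rename]
    rw [h₁, B.isElgot.compositionality, hsol.inducedSolution_eq, Category.assoc, hp,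
      toEquation_combineStr, rename_combine]
  · have key {X : C} (hX : P X) (x : X ⟶ Y) : x ≫ invRight Φ.pt ≫ p = x ≫ h := by
      rw [← Category.assoc, comp_invRight hX x, hp]
      have hr : rename h (toEquation (x ≫ plusInr F Y X)) =
          (x ≫ h) ≫ (coprod.inr : B.carrier ⟶ F.obj X ⨿ B.carrier) := by
        refine (Category.assoc x _ _).trans ?_
        rw [Category.assoc]
        exact congr_arg (x ≫ ·) (coprod.inr_map _ _)
      refine (B.isElgot.isSolution hX _).trans ?_
      rw [hr]
      simp [coprod.inr_desc]
    exact hy.hom_ext fun i => key (hD i) (y.app i)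
  · refine ElgotAlgebra.Hom.ext (hom_ext_leg hΦ fun V s hV => ?_)
    have := hP' hV
    have h' := p'.preserves hV (rename (invRight Φ.pt) (toEquation s))
    dsimp only at h' hp' ⊢
    rw [hp, ← inducedSolution_rename_invRight hy hD hsol hV s, ← h', ← hp']
    simp [rename]

end Free

/-! ### Varieties -/

section Varieties

variable {S : Type u} {T : Monad (S → Type u)}

/-- The free algebra on one generator of sort `s` represents the elements of sort `s`, so that a
morphism is invertible if morphisms from ffg objects lift uniquely along it. -/
theorem isDetecting_isFfg : (IsFfg T).IsDetecting := by
  classical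
  intro A B f h
  have hbij (s : S) : Function.Bijective (f.f s) := by
    let X : S → Type u := fun t => ULift.{u} (PLift (t = s))
    have hX : IsFfg T (T.free.obj X) :=
      ⟨X, Finite.of_injective (β := Unit) (fun _ => ()) (by
        rintro ⟨t, ⟨⟨rfl⟩⟩⟩ ⟨_, ⟨⟨rfl⟩⟩⟩ -
        rfl), ⟨Iso.refl _⟩⟩
    let el {A : T.Algebra} (a : A.A s) : X ⟶ A.A := fun t => TypeCat.ofHom fun p =>
      cast (congr_arg A.A p.down.down.symm) a
    have lift (k : X ⟶ B.A) : ∃! k' : X ⟶ A.A, k' ≫ f.f = k := by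
      obtain ⟨g, hg, hg'⟩ := h _ hX ((T.adj.homEquiv X B).symm k)
      refine ⟨T.adj.homEquiv X A g, ?_, fun k' hk' => ?_⟩
      · refine (T.adj.homEquiv_naturality_right g f).symm.trans ?_
        exact (congr_arg (T.adj.homEquiv X B) hg).trans (Equiv.apply_symm_apply _ _)
      · refine ((T.adj.homEquiv X A).symm_apply_eq).1 (hg' _ ?_)
        exact (T.adj.homEquiv_naturality_right_symm k' f).symm.trans (congr_arg _ hk')
    constructor
    · intro a b hab
      have e : el a ≫ f.f = el b ≫ f.f := by
        funext t
        ext ⟨⟨rfl⟩⟩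
        exact hab
      have := (lift (el b ≫ f.f)).unique e rfl
      exact ConcreteCategory.congr_hom (congr_fun this s) ⟨⟨rfl⟩⟩
    · intro b
      obtain ⟨k, hk, -⟩ := lift (el b)
      exact ⟨k s ⟨⟨rfl⟩⟩, ConcreteCategory.congr_hom (congr_fun hk s) ⟨⟨rfl⟩⟩⟩
  have : IsIso (T.forget.map f) := by
    refine ⟨fun s => TypeCat.ofHom (Equiv.ofBijective _ (hbij s)).symm, ?_, ?_⟩
    · funext s
      ext a
      exact (Equiv.ofBijective _ (hbij s)).symm_apply_apply a
    · funext s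
      ext b
      exact (Equiv.ofBijective _ (hbij s)).apply_symm_apply b
  exact isIso_of_reflects_iso f T.forget

/-- A free object is a directed colimit of ffg objects. -/
theorem IsFreeObject.exists_isColimit {Y : T.Algebra} (hY : IsFreeObject T Y) :
    ∃ (I : Type u) (_ : SmallCategory I) (_ : IsFiltered I) (D : I ⥤ T.Algebra)
      (y : D ⟶ (Functor.const I).obj Y),
      Nonempty (IsColimit (Cocone.mk Y y)) ∧ ∀ i, IsFfg T (D.obj i) := by
  classical
  obtain ⟨Y₀, ⟨i⟩⟩ := hY
  have : T.free.IsLeftAdjoint := ⟨_, ⟨T.adj⟩⟩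
  refine ⟨Finset (Σ s, Y₀ s), inferInstance, inferInstance, finiteSubsets Y₀ ⋙ T.free,
    (T.free.mapCocone (finiteSubsetsCocone Y₀)).ι ≫ (Functor.const _).map i.inv, ⟨?_⟩,
    fun E => ⟨_, finite_finiteSubsets E, ⟨Iso.refl _⟩⟩⟩
  exact (isColimitOfPreserves T.free (finiteSubsetsIsColimit Y₀)).ofIsoColimit
    (Cocone.ext i.symm (fun E => rfl))

end Varieties

end FfgElgot

open FfgElgot in
theorem mainTheorem3 {S : Type u} (T : Monad (S → Type u))
    [PreservesFilteredColimits T.toFunctor]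
    (F : T.Algebra ⥤ T.Algebra) (hF : PreservesSiftedColimits.{u} F)
    (Y : T.Algebra) (hY : IsFreeObject T Y) :
    HasColimit (coalgebraInclusion (IsFfg T) (plusConst F Y)) ∧
    ∀ Φ : Cocone (coalgebraInclusion (IsFfg T) (plusConst F Y)), IsColimit Φ →
      ∃ (_ : IsIso Φ.pt.str) (sol : SolutionOperation (IsFfg T) (plusConst F Y) Φ.pt.V)
        (_ : IsCanonicalSolution Φ sol)
        (hE : IsElgot (IsFfg T) F (invLeft Φ.pt) (inducedSolution sol)),
        IsElgot (IsFfg T) (plusConst F Y) (inv Φ.pt.str) sol ∧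
        IsFreeOn ⟨Φ.pt.V, invLeft Φ.pt, inducedSolution sol, hE⟩ (invRight Φ.pt) := by
  let J := CoalgebraIn (IsFfg T) (plusConst F Y)
  have : IsSifted (SmallModel.{u} J) := IsSifted.isSifted_of_equiv (equivSmallModel J).symm
  have := hF (SmallModel.{u} J)
  have : PreservesColimitsOfShape J F :=
    preservesColimitsOfShape_of_equiv (equivSmallModel J).symm F
  have : HasColimitsOfShape J T.Algebra :=
    hasColimitsOfShape_of_equivalence (equivSmallModel J).symm
  have := preservesColimitsOfShape_plusConst F Y J
  have hP : ∀ ⦃X : T.Algebra⦄, IsFfg T X →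
      PreservesColimitsOfShape J (coyoneda.obj (.op X)) :=
    fun X hX => preservesColimitsOfShape_coyoneda_of_isFfg hX J
  refine ⟨inferInstance, fun Φ hΦ => ?_⟩
  have hiso := isIso_str hP hΦ isDetecting_isFfg
  obtain ⟨sol, hsol⟩ := exists_isCanonicalSolution hP hΦ
  have hE := isElgot_of_isCanonicalSolution hP hΦ hsol
  obtain ⟨I, _, _, D, y, ⟨hy⟩, hD⟩ := hY.exists_isColimit
  have := IsFiltered.isSifted (C := I)
  exact ⟨hiso, sol, hsol, hE.inducedSolution, hE, isFreeOn hP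
    (fun X hX => preservesColimitsOfShape_coyoneda_of_isFfg hX I) hy hD hΦ hsol _⟩
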